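/- Let $A\in SL(d,\mathbb Z)$ be hyperbolic (no complex eigenvalue of $A$ lies on the unit circle) and assume that $A$ has exactly two distinct complex eigenvalues $\lambda_s,\lambda_u$, with $0<|\lambda_s|<1<|\lambda_u|$. Let $d_s$ be the (algebraic) multiplicity of $\lambda_s$. Let $f_A(x)=Ax \bmod 1$ be the induced automorphism of the torus $\mathbb T^d=\mathbb R^d/\mathbb Z^d$, where $\mathbb T^d$ carries the flat metric $\mathrm d$ induced by the Euclidean one. For each $j\ge 1$ let $\varphi_j:\mathbb N\to(0,1]$ be a function and $(z_j^n)_{n\ge 0}$ a sequence of points of $\mathbb T^d$, and put $$\mathfrak S_j=\{x\in\mathbb T^d:\ \mathrm d(f_A^n(x),z_j^n)<\varphi_j(n)\ \text{for infinitely many } n\in\mathbb N\},\qquad E=\bigcap_{j=1}^\infty \mathfrak S_j,$$ $$\underline\tau=\sup_{j\ge1}\ \liminf_{n\to\infty}-\frac{\ln\varphi_j(n)}{n}\in[0,+\infty].$$ For $Z\subseteq\mathbb T^d$ let $h_{top}(f_A,Z)$ denote the Bowen topological entropy: with $B_n(x,\varepsilon)=\{y:\mathrm d(f_A^i(x),f_A^i(y))<\varepsilon,\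 0\le i\le n-1\}$, let $\mathcal M^s_{N,\varepsilon}(Z)=\inf\sum_i e^{-sn_i}$ over all finite or countable families of sets $B_{n_i}(x_i,\varepsilon)$ with $n_i\ge N$ that cover $Z$; then $$h_{top}(f_A,Z)=\lim_{\varepsilon\to0}\ \inf\{s\ge0:\ \lim_{N\to\infty}\mathcal M^s_{N,\varepsilon}(Z)=0\}.$$ Let $\dim_H$ denote Hausdorff dimension. 1. If $\underline\tau<-\ln|\lambda_s|$, then $E$ is non-empty, $$h_{top}(f_A,E)=d_s\,\frac{\ln|\lambda_s|^{-1}\ln|\lambda_u|-\underline\tau\ln|\lambda_u|}{\ln|\lambda_u|+\underline\tau}\quad\text{and}\quad \dim_H E=d_s\,\frac{\ln|\lambda_s|^{-1}+\ln|\lambda_u|}{\ln|\lambda_u|+\underline\tau}.$$ 2. If $\underline\tau=-\ln|\lambda_s|$, then $h_{top}(f_A,E)=0$ and $\dim_H E\le d_s$. 3. If $\underline\tau>-\ln|\lambda_s|$, then $h_{top}(f_A,E)=0$ and $\dim_H E=0$. -/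

import Mathlib

open scoped ENNReal NNReal

noncomputable section

namespace ShrinkingTarget

section Dynamics

variable {X : Type*} [MetricSpace X]

/-- The shrinking target set `{x : d(fⁿ x, zₙ) < φ(n) for infinitely many n ∈ S}`. -/
def shrinkingTarget (f : X → X) (φ : ℕ → ℝ) (z : ℕ → X) (S : Set ℕ) : Set X :=
  {x | {n | n ∈ S ∧ dist (f^[n] x) (z n) < φ n}.Infinite}

/-- The dynamical ball `Bₙ(x, ε, f) = {y : d(fⁱ x, fⁱ y) < ε for 0 ≤ i ≤ n - 1}`. -/
def bowenBall (f : X → X) (n : ℕ) (x : X) (ε : ℝ) : Set X :=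
  {y | ∀ i < n, dist (f^[i] x) (f^[i] y) < ε}

/-- `inf ∑ᵢ exp (-s nᵢ)` over all finite or countable families of dynamical balls
`B_{nᵢ}(xᵢ, ε, f)` with `nᵢ ≥ N` that cover `Z`. A family is given by the set of its
pairs `(xᵢ, nᵢ)`. -/
def bowenPreMeasure (f : X → X) (s : ℝ≥0) (N : ℕ) (ε : ℝ) (Z : Set X) : ℝ≥0∞ :=
  ⨅ (C : Set (X × ℕ)) (_ : C.Countable) (_ : ∀ p ∈ C, N ≤ p.2)
    (_ : Z ⊆ ⋃ p ∈ C, bowenBall f p.2 p.1 ε),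
    ∑' p : C, ENNReal.ofReal (Real.exp (-(s * (p : X × ℕ).2)))

/-- The limit of `bowenPreMeasure f s N ε Z` as `N → ∞`; it is a supremum because the quantity
is nondecreasing in `N`. -/
def bowenMeasure (f : X → X) (s : ℝ≥0) (ε : ℝ) (Z : Set X) : ℝ≥0∞ :=
  ⨆ N : ℕ, bowenPreMeasure f s N ε Z

/-- Bowen topological entropy of `f` on `Z` at scale `ε`: the infimum of the `s ≥ 0` for which
the measure vanishes (`∞` if there is none). -/
def bowenEntropyAt (f : X → X) (ε : ℝ) (Z : Set X) : ℝ≥0∞ :=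
  ⨅ (s : ℝ≥0) (_ : bowenMeasure f s ε Z = 0), (s : ℝ≥0∞)

/-- Bowen topological entropy of `f` on an arbitrary subset `Z`: the limit of the entropies at
scale `ε` as `ε → 0`; it is a supremum because they are nonincreasing in `ε`. -/
def bowenEntropy (f : X → X) (Z : Set X) : ℝ≥0∞ :=
  ⨆ (ε : ℝ) (_ : 0 < ε), bowenEntropyAt f ε Z

end Dynamics

/-- `liminf_{n → ∞} -ln φ(n) / n`, an extended real. -/
def lowerRate (φ : ℕ → ℝ) : EReal :=
  Filter.liminf (fun n : ℕ => ((-Real.log (φ n) / n : ℝ) : EReal)) Filter.atTop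

/-- The supremum over `j` of the lower rates of the `φ j`. -/
def supLowerRate (φ : ℕ → ℕ → ℝ) : EReal :=
  ⨆ j : ℕ, lowerRate (φ j)

section Torus

/-- The torus `ℝᵈ / ℤᵈ` with its flat metric, the quotient of the Euclidean one:
`d(x, y)² = ∑ᵢ d(xᵢ, yᵢ)²`, where the distance in each coordinate is that of `ℝ / ℤ`. -/
abbrev Torus (d : ℕ) : Type := PiLp 2 (fun _ : Fin d => UnitAddCircle)

/-- The map `x ↦ A x mod 1` of the torus. -/
def toralMap {d : ℕ} (A : Matrix (Fin d) (Fin d) ℤ) (x : Torus d) : Torus d :=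
  WithLp.toLp 2 (fun i => ∑ j, A i j • x j)

/-- An integer matrix, seen as a complex one. -/
def toComplex {d : ℕ} (A : Matrix (Fin d) (Fin d) ℤ) : Matrix (Fin d) (Fin d) ℂ :=
  A.map (Int.cast : ℤ → ℂ)

/-- No (complex) eigenvalue lies on the unit circle. -/
def IsHyperbolic {d : ℕ} (A : Matrix (Fin d) (Fin d) ℤ) : Prop :=
  ∀ μ ∈ spectrum ℂ (toComplex A), ‖μ‖ ≠ 1

end Torus

end ShrinkingTarget

end

/-! Write `Ls` = -ln|λ_s|, `Lu` = ln|λ_u|, and `m`, `k` for the multiplicities of λ_s, λ_u. Both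
eigenvalues are real, so ℝᵈ splits into two generalized eigenspaces on which A acts with exponential
rates -`Ls` and `Lu`, up to subexponential factors; det A = 1 gives m·Ls = k·Lu
(`exists_splitting`).

Upper bounds use a single target, one whose lower rate exceeds a given t < τ. The points that hit it
at time n lie in the preimage of a ball of radius exp(-tn). As f is injective, this is one box, of
stable size exp((Ls-t)n) and unstable size exp(-(Lu+t)n). Cutting it into cubes of side
exp(-(Lu+t)n) takes about exp(m(Ls+Lu)n) pieces and gives the dimension (`dimH_le_of_hits`). Cutting
it into about exp(m(Ls-t)n) pieces whose stable size is just below 1 gives sets that stay small for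
about (1+t/Lu)n iterates, hence the entropy (`bowenEntropy_le_of_hits`). When τ > Ls, some t > Ls is
available, a bounded number of pieces is enough, and both quantities vanish.

Lower bounds use τ < t < Ls, for which every target has radius above exp(-tn) infinitely often. The
image under A^j, j ≈ tn/Ls, of a bounded set that covers the torus is exp(-tn)-thin in the stable
direction and has unstable size exp(Lu·tn/Ls). Pulling back by n steps shows that, near any unstable
coordinate, at distance exp(-an) with a < Lu(1-t/Ls), there is a ball of radius exp(-bn), b > Lu+t,
which hits the target for every stable coordinate in the unit ball (`eventually_exists_ball_hits`).
Nesting such balls at sparse times, with every target recurring infinitely often, gives a Cantor set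
of stable leaves inside E whose parametrization has a Hölder inverse of any exponent below Θ =
Lu(1-τ/Ls)/(Lu+τ) (`exists_cantor_map`). Mass distribution yields dimension m + Θk and entropy
Lu·Θ·k, which equal the upper bounds because m·Ls = k·Lu. -/

open scoped ENNReal NNReal

noncomputable section

namespace ShrinkingTarget

/-! ### Exponential growth of operators that are a scalar plus a nilpotent. -/

section Growth

/-- The powers of `a + N` with `N` nilpotent grow at most like `(|a| + δ) ^ n`. -/
theorem exists_norm_algebraMap_add_nilpotent_pow_le {R : Type*} [NormedRing R] [NormOneClass R]
    [NormedAlgebra ℝ R] (a : ℝ) {N : R} (hN : IsNilpotent N) {δ : ℝ} (hδ : 0 < δ) :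
    ∃ C : ℝ, 0 < C ∧ ∀ n : ℕ, ‖(algebraMap ℝ R a + N) ^ n‖ ≤ C * (|a| + δ) ^ n := by
  obtain ⟨D, hD⟩ := hN
  refine ⟨1 + ∑ j ∈ Finset.range D, (‖N‖ / δ) ^ j, by positivity, fun n => ?_⟩
  have hcomm : Commute N (algebraMap ℝ R a) := (Algebra.commutes a N).symm
  rw [add_comm, hcomm.add_pow]
  have hterm : ∀ j ∈ Finset.range (n + 1),
      ‖N ^ j * algebraMap ℝ R a ^ (n - j) * (n.choose j : R)‖ ≤
        if j < D then (‖N‖ / δ) ^ j * (|a| + δ) ^ n else 0 := by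
    intro j hj
    split_ifs with hjD
    -- The left side is one term of the binomial expansion of `(δ + |a|) ^ n`; this absorbs the
    -- polynomial growth of the binomial coefficient.
    · have h1 : δ ^ j * |a| ^ (n - j) * (n.choose j : ℝ) ≤ (|a| + δ) ^ n := by
        rw [add_comm, add_pow]
        exact Finset.single_le_sum
          (f := fun j => δ ^ j * |a| ^ (n - j) * (n.choose j : ℝ))
          (fun i _ => by positivity) hj
      have h2 : ‖N ^ j * algebraMap ℝ R a ^ (n - j) * (n.choose j : R)‖ ≤
          ‖N‖ ^ j * |a| ^ (n - j) * (n.choose j : ℝ) := by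
        refine (norm_mul_le _ _).trans ?_
        refine mul_le_mul ((norm_mul_le _ _).trans (mul_le_mul (norm_pow_le _ _) ?_
          (norm_nonneg _) (by positivity))) ?_ (norm_nonneg _) (by positivity)
        · refine (norm_pow_le _ _).trans ?_
          rw [norm_algebraMap', Real.norm_eq_abs]
        · refine (Nat.norm_cast_le _).trans ?_
          simp
      refine h2.trans ?_
      calc ‖N‖ ^ j * |a| ^ (n - j) * (n.choose j : ℝ)
          = (‖N‖ / δ) ^ j * (δ ^ j * |a| ^ (n - j) * (n.choose j : ℝ)) := by
            rw [div_pow]; field_simp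
        _ ≤ _ := by gcongr
    · rw [pow_eq_zero_of_le (not_lt.1 hjD) hD]; simp
  refine (norm_sum_le _ _).trans ((Finset.sum_le_sum hterm).trans ?_)
  rw [← Finset.sum_filter]
  calc ∑ j ∈ Finset.range (n + 1) with j < D, (‖N‖ / δ) ^ j * (|a| + δ) ^ n
      ≤ ∑ j ∈ Finset.range D, (‖N‖ / δ) ^ j * (|a| + δ) ^ n :=
        Finset.sum_le_sum_of_subset_of_nonneg (fun j hj => by simp at hj ⊢; exact hj.2)
          (fun i _ _ => by positivity)
    _ = (∑ j ∈ Finset.range D, (‖N‖ / δ) ^ j) * (|a| + δ) ^ n := by rw [Finset.sum_mul]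
    _ ≤ _ := by gcongr; linarith

/-- `T` has exponential growth rate at most `L`. -/
def GrowthAtMost {R : Type*} [NormedRing R] (T : R) (L : ℝ) : Prop :=
  ∀ ε : ℝ, 0 < ε → ∃ C : ℝ, 0 < C ∧ ∀ n : ℕ, ‖T ^ n‖ ≤ C * Real.exp ((L + ε) * n)

theorem growthAtMost_of_isNilpotent_sub {R : Type*} [NormedRing R] [NormOneClass R]
    [NormedAlgebra ℝ R] {a : ℝ} (ha : a ≠ 0) {T : R} (hT : IsNilpotent (T - algebraMap ℝ R a)) :
    GrowthAtMost T (Real.log |a|) := by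
  intro ε hε
  have ha' : 0 < |a| := abs_pos.2 ha
  -- This choice of δ makes `|a| + δ` equal to `exp (log |a| + ε)`.
  have hδ : 0 < |a| * (Real.exp ε - 1) := by
    have := Real.add_one_lt_exp hε.ne'
    exact mul_pos ha' (by linarith)
  obtain ⟨C, hC, h⟩ := exists_norm_algebraMap_add_nilpotent_pow_le a hT hδ
  refine ⟨C, hC, fun n => ?_⟩
  have := h n
  rw [add_sub_cancel] at this
  refine this.trans (le_of_eq ?_)
  congr 1
  rw [mul_comm (Real.log |a| + ε), Real.exp_nat_mul, Real.exp_add, Real.exp_log ha']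
  congr 1
  ring

/-- T⁻¹ - a⁻¹ = -a⁻¹ T⁻¹ (T - a), and all factors commute. This supplies the growth rate of the
inverse. -/
theorem isNilpotent_inv_sub {R : Type*} [Ring R] [Algebra ℝ R] {a : ℝ} (ha : a ≠ 0) (T : Rˣ)
    (hT : IsNilpotent ((T : R) - algebraMap ℝ R a)) :
    IsNilpotent (((T⁻¹ : Rˣ) : R) - algebraMap ℝ R a⁻¹) := by
  have hc : Commute ((T⁻¹ : Rˣ) : R) ((T : R) - algebraMap ℝ R a) :=
    (((Commute.refl (T : R)).units_inv_left)).sub_right (Algebra.commutes a _).symm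
  have h1 : (((T⁻¹ : Rˣ) : R) - algebraMap ℝ R a⁻¹) =
      algebraMap ℝ R (-a⁻¹) * (((T⁻¹ : Rˣ) : R) * ((T : R) - algebraMap ℝ R a)) := by
    rw [mul_sub, Units.inv_mul, ← Algebra.commutes, mul_sub, ← mul_assoc, ← map_mul]
    have : -a⁻¹ * a = -1 := by field_simp
    rw [this]
    simp only [map_neg, map_one, mul_one]
    noncomm_ring
  rw [h1]
  have hc' : Commute (algebraMap ℝ R (-a⁻¹)) (((T⁻¹ : Rˣ) : R) * ((T : R) - algebraMap ℝ R a)) :=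
    Algebra.commutes _ _
  exact hc'.isNilpotent_mul_left (hc.isNilpotent_mul_left hT)

theorem isUnit_of_isNilpotent_sub {R : Type*} [Ring R] [Algebra ℝ R] {a : ℝ} (ha : a ≠ 0) {T : R}
    (hT : IsNilpotent (T - algebraMap ℝ R a)) : IsUnit T := by
  have := hT.isUnit_add_left_of_commute (ha.isUnit.map (algebraMap ℝ R))
    (Algebra.commutes a _).symm
  simpa using this

end Growth

/-! ### The stable and unstable splitting of ℝᵈ. -/

/-- A splitting of `ℝᵈ` into a stable and an unstable subspace of the linear map `A`, in
coordinates, with exponential contraction rate `Ls` and expansion rate `Lu`. The norm bound on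
`e` makes the images of unit balls embed into the torus. -/
structure Splitting {d : ℕ} (A : Matrix (Fin d) (Fin d) ℤ) (Ls Lu : ℝ) (m k : ℕ) where
  /-- The coordinates. -/
  e : ((Fin m → ℝ) × (Fin k → ℝ)) ≃L[ℝ] (Fin d → ℝ)
  /-- The stable part of `A`. -/
  S : ((Fin m → ℝ) →L[ℝ] (Fin m → ℝ))ˣ
  /-- The unstable part of `A`. -/
  U : ((Fin k → ℝ) →L[ℝ] (Fin k → ℝ))ˣ
  apply_e : ∀ s u, (A.map (Int.cast : ℤ → ℝ)).mulVec (e (s, u)) =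
    e ((S : (Fin m → ℝ) →L[ℝ] (Fin m → ℝ)) s, (U : (Fin k → ℝ) →L[ℝ] (Fin k → ℝ)) u)
  norm_e_le : ∀ v, ‖e v‖ ≤ ‖v‖ / 8
  growth_S : GrowthAtMost (S : (Fin m → ℝ) →L[ℝ] (Fin m → ℝ)) (-Ls)
  growth_S_inv : GrowthAtMost ((S⁻¹ : _ˣ) : (Fin m → ℝ) →L[ℝ] (Fin m → ℝ)) Ls
  growth_U : GrowthAtMost (U : (Fin k → ℝ) →L[ℝ] (Fin k → ℝ)) Lu
  growth_U_inv : GrowthAtMost ((U⁻¹ : _ˣ) : (Fin k → ℝ) →L[ℝ] (Fin k → ℝ)) (-Lu)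

section Existence

/-- The action of `T` on the generalized eigenspace of a nonzero real number, in coordinates. -/
theorem exists_unit_conj_maxGenEigenspace {V : Type*} [AddCommGroup V] [Module ℝ V]
    [FiniteDimensional ℝ V] (T : Module.End ℝ V) {a : ℝ} (ha : a ≠ 0) {m : ℕ} (hm : 0 < m)
    (hfin : Module.finrank ℝ (T.maxGenEigenspace a) = m) :
    ∃ (c : (Fin m → ℝ) ≃ₗ[ℝ] T.maxGenEigenspace a)
      (S : ((Fin m → ℝ) →L[ℝ] (Fin m → ℝ))ˣ),
      (∀ s, T (c s) = c ((S : (Fin m → ℝ) →L[ℝ] (Fin m → ℝ)) s)) ∧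
      GrowthAtMost (S : (Fin m → ℝ) →L[ℝ] (Fin m → ℝ)) (Real.log |a|) ∧
      GrowthAtMost ((S⁻¹ : _ˣ) : (Fin m → ℝ) →L[ℝ] (Fin m → ℝ)) (-Real.log |a|) := by
  -- The identity operator has norm 1 only on a nonzero space.
  have : Nonempty (Fin m) := ⟨⟨0, hm⟩⟩
  have hmaps := T.mapsTo_maxGenEigenspace_of_comm rfl a
  have hnil := T.isNilpotent_restrict_maxGenEigenspace_sub_algebraMap a
  let c : (Fin m → ℝ) ≃ₗ[ℝ] T.maxGenEigenspace a :=
    LinearEquiv.ofFinrankEq _ _ (by simp [hfin])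
  let Φ : Module.End ℝ (T.maxGenEigenspace a) ≃ₐ[ℝ] ((Fin m → ℝ) →L[ℝ] (Fin m → ℝ)) :=
    (c.symm.conjAlgEquiv ℝ).trans (Module.End.toContinuousLinearMap (Fin m → ℝ))
  have hnil' : IsNilpotent (Φ (T.restrict hmaps) - algebraMap ℝ _ a) := by
    have hres : LinearMap.restrict (T - algebraMap ℝ (Module.End ℝ V) a)
        (T.mapsTo_maxGenEigenspace_of_comm (Algebra.mul_sub_algebraMap_commutes T a) a) =
        T.restrict hmaps - algebraMap ℝ _ a := by
      ext; rfl
    rw [hres] at hnil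
    have h2 : Φ (T.restrict hmaps - algebraMap ℝ _ a) =
      Φ (T.restrict hmaps) - algebraMap ℝ _ a := by rw [map_sub, AlgEquiv.commutes]
    rw [← h2]
    exact hnil.map Φ
  obtain ⟨S, hS⟩ := isUnit_of_isNilpotent_sub ha hnil'
  rw [← hS] at hnil'
  refine ⟨c, S, fun s => ?_, growthAtMost_of_isNilpotent_sub ha hnil', ?_⟩
  · rw [hS]
    change T (c s) = c (c.symm (T.restrict hmaps (c s)))
    rw [LinearEquiv.apply_symm_apply]
    rfl
  · have := growthAtMost_of_isNilpotent_sub (inv_ne_zero ha) (isNilpotent_inv_sub ha S hnil')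
    rwa [abs_inv, Real.log_inv] at this

/-- The characteristic polynomial splits over ℂ, so the degree and the determinant can be read off
from its multiset of roots. -/
theorem card_roots_of_spectrum_eq_pair {d : ℕ} (B : Matrix (Fin d) (Fin d) ℂ) {a b : ℂ}
    (hab : a ≠ b) (hspec : spectrum ℂ B = {a, b}) :
    B.charpoly.rootMultiplicity a + B.charpoly.rootMultiplicity b = d ∧
      a ^ B.charpoly.rootMultiplicity a * b ^ B.charpoly.rootMultiplicity b = B.det := by
  classical
  have hroots : B.charpoly.roots.toFinset = {a, b} := by
    ext x
    rw [Multiset.mem_toFinset, Polynomial.mem_roots B.charpoly_monic.ne_zero,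
      ← Matrix.mem_spectrum_iff_isRoot_charpoly, hspec]
    simp
  constructor
  · have h1 := Multiset.toFinset_sum_count_eq B.charpoly.roots
    rw [hroots, Finset.sum_pair hab, Polynomial.count_roots, Polynomial.count_roots,
      IsAlgClosed.card_roots_eq_natDegree, B.charpoly_natDegree_eq_dim, Fintype.card_fin] at h1
    exact h1
  · rw [Matrix.det_eq_prod_roots_charpoly, Finset.prod_multiset_count, hroots,
      Finset.prod_pair hab, Polynomial.count_roots, Polynomial.count_roots]

theorem conj_mem_spectrum_toComplex {d : ℕ} (A : Matrix (Fin d) (Fin d) ℤ) {μ : ℂ}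
    (h : μ ∈ spectrum ℂ (toComplex A)) : (starRingEnd ℂ) μ ∈ spectrum ℂ (toComplex A) := by
  rw [Matrix.mem_spectrum_iff_isRoot_charpoly] at h ⊢
  have hA : toComplex A = A.map (Int.castRingHom ℂ) := rfl
  rw [hA, Matrix.charpoly_map, Polynomial.IsRoot.def, Polynomial.eval_map] at h ⊢
  have := congrArg (starRingEnd ℂ) h
  rw [Polynomial.hom_eval₂, map_zero] at this
  rw [RingHom.ext_int ((starRingEnd ℂ).comp (Int.castRingHom ℂ)) (Int.castRingHom ℂ)] at this
  exact this

/-- A matrix in `SL(d, ℤ)` with one contracted and one expanded eigenvalue has a splitting whose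
dimensions are the algebraic multiplicities, and it contracts volume on the stable side as much
as it expands on the unstable one. -/
theorem exists_splitting {d : ℕ} (A : Matrix.SpecialLinearGroup (Fin d) ℤ) {lams lamu : ℂ}
    (hspec : spectrum ℂ (toComplex (A : Matrix (Fin d) (Fin d) ℤ)) = {lams, lamu})
    (hs0 : 0 < ‖lams‖) (hs1 : ‖lams‖ < 1) (hu1 : 1 < ‖lamu‖) :
    ∃ k : ℕ, 0 < (toComplex (A : Matrix (Fin d) (Fin d) ℤ)).charpoly.rootMultiplicity lams ∧
      0 < k ∧
      ((toComplex (A : Matrix (Fin d) (Fin d) ℤ)).charpoly.rootMultiplicity lams : ℝ) *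
        (-Real.log ‖lams‖) = k * Real.log ‖lamu‖ ∧
      Nonempty (Splitting (A : Matrix (Fin d) (Fin d) ℤ) (-Real.log ‖lams‖) (Real.log ‖lamu‖)
        ((toComplex (A : Matrix (Fin d) (Fin d) ℤ)).charpoly.rootMultiplicity lams) k) := by
  have hne : lams ≠ lamu := by
    rintro rfl; linarith
  obtain ⟨hsum, hprod⟩ := card_roots_of_spectrum_eq_pair _ hne hspec
  set B := toComplex (A : Matrix (Fin d) (Fin d) ℤ) with hB
  set m := B.charpoly.rootMultiplicity lams with hm
  set k := B.charpoly.rootMultiplicity lamu with hk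
  have hdet : B.det = 1 := by
    have : B = (Int.castRingHom ℂ).mapMatrix (A : Matrix (Fin d) (Fin d) ℤ) := rfl
    rw [this, ← RingHom.map_det, A.det_coe, map_one]
  have hmpos : 0 < m := by
    rw [hm, Polynomial.rootMultiplicity_pos B.charpoly_monic.ne_zero,
      ← Matrix.mem_spectrum_iff_isRoot_charpoly, hspec]; simp
  have hkpos : 0 < k := by
    rw [hk, Polynomial.rootMultiplicity_pos B.charpoly_monic.ne_zero,
      ← Matrix.mem_spectrum_iff_isRoot_charpoly, hspec]; simp
  -- Conjugation maps the spectrum to itself and preserves moduli, and the two eigenvalues have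
  -- different moduli, so each is fixed.
  have hreal : ∀ μ ∈ spectrum ℂ B, ∃ r : ℝ, (r : ℂ) = μ := by
    intro μ hμ
    have hc := conj_mem_spectrum_toComplex _ hμ
    have hn : ‖(starRingEnd ℂ) μ‖ = ‖μ‖ := RCLike.norm_conj μ
    apply Complex.conj_eq_iff_real.1 _ |>.imp fun r hr => hr.symm
    rw [← hB, hspec] at hc
    rw [hspec] at hμ
    rcases hμ with rfl | rfl <;> rcases hc with hc | hc
    · exact hc
    · rw [hc] at hn; linarith
    · rw [hc] at hn; linarith
    · exact hc
  obtain ⟨a, rfl⟩ := hreal lams (by rw [hspec]; simp)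
  obtain ⟨b, rfl⟩ := hreal lamu (by rw [hspec]; simp)
  simp only [Complex.norm_real, Real.norm_eq_abs] at hs0 hs1 hu1 ⊢
  have ha : a ≠ 0 := abs_pos.1 hs0
  have hb : b ≠ 0 := by rintro rfl; simp at hu1; linarith
  have hab : a ≠ b := fun h => hne (by rw [h])
  refine ⟨k, hmpos, hkpos, ?_, ?_⟩
  · have := congrArg (fun w : ℂ => Real.log ‖w‖) (hprod.trans hdet)
    simp only [norm_mul, norm_pow, Complex.norm_real, Real.norm_eq_abs, norm_one,
      Real.log_one] at this
    rw [Real.log_mul (by positivity) (by positivity), Real.log_pow, Real.log_pow] at this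
    linarith
  · let AR : Matrix (Fin d) (Fin d) ℝ := (A : Matrix (Fin d) (Fin d) ℤ).map (Int.cast : ℤ → ℝ)
    have hBA : B = AR.map (algebraMap ℝ ℂ) := by
      ext i j; simp [hB, AR, toComplex]
    let T : Module.End ℝ (Fin d → ℝ) := Matrix.toLin' AR
    have hchar : T.charpoly = AR.charpoly := Matrix.charpoly_toLin' AR
    have hmult : ∀ r : ℝ, T.charpoly.rootMultiplicity r = B.charpoly.rootMultiplicity (r : ℂ) := by
      intro r
      rw [hchar, hBA, Matrix.charpoly_map]
      exact Polynomial.eq_rootMultiplicity_map (algebraMap ℝ ℂ).injective r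
    have hfa : Module.finrank ℝ (T.maxGenEigenspace a) = m := by
      rw [LinearMap.finrank_maxGenEigenspace_eq, hmult]
    have hfb : Module.finrank ℝ (T.maxGenEigenspace b) = k := by
      rw [LinearMap.finrank_maxGenEigenspace_eq, hmult]
    have hdisj : Disjoint (T.maxGenEigenspace a) (T.maxGenEigenspace b) :=
      T.disjoint_genEigenspace hab ⊤ ⊤
    have hcompl : IsCompl (T.maxGenEigenspace a) (T.maxGenEigenspace b) :=
      ⟨hdisj, codisjoint_iff.2 (Submodule.eq_top_of_disjoint _ _
        (by rw [hfa, hfb]; simp [hsum]) hdisj)⟩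
    obtain ⟨ca, S, hS, hS1, hS2⟩ := exists_unit_conj_maxGenEigenspace T ha hmpos hfa
    obtain ⟨cb, U, hU, hU1, hU2⟩ := exists_unit_conj_maxGenEigenspace T hb hkpos hfb
    let e₀ : ((Fin m → ℝ) × (Fin k → ℝ)) ≃L[ℝ] (Fin d → ℝ) :=
      ((ca.prodCongr cb).trans (Submodule.prodEquivOfIsCompl _ _ hcompl)).toContinuousLinearEquiv
    have he₀ : ∀ s u, e₀ (s, u) = (ca s : Fin d → ℝ) + cb u := fun s u => by
      simp [e₀]
    set K : ℝ := ‖(e₀ : ((Fin m → ℝ) × (Fin k → ℝ)) →L[ℝ] (Fin d → ℝ))‖ with hK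
    let c : ℝˣ := Units.mk0 ((8 * (K + 1))⁻¹) (by positivity)
    let e := e₀.trans (ContinuousLinearEquiv.smulLeft c)
    have he : ∀ v, e v = (8 * (K + 1))⁻¹ • e₀ v := fun v => rfl
    refine ⟨⟨e, S, U, fun s u => ?_, fun v => ?_, by simpa using hS1, hS2, hU1, hU2⟩⟩
    · rw [he, he, he₀, he₀, ← hS, ← hU, Matrix.mulVec_smul, ← map_add]
      rfl
    · rw [he, norm_smul, Real.norm_of_nonneg (by positivity)]
      have h1 : ‖e₀ v‖ ≤ K * ‖v‖ :=
        (e₀ : ((Fin m → ℝ) × (Fin k → ℝ)) →L[ℝ] (Fin d → ℝ)).le_opNorm v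
      have hK0 : 0 ≤ K := norm_nonneg _
      rw [inv_mul_le_iff₀ (by positivity)]
      nlinarith [norm_nonneg v]

end Existence

/-! ### The projection from ℝᵈ to the torus. -/

section TorusProjection

variable {d : ℕ}

/-- The projection `ℝᵈ → 𝕋ᵈ`. -/
def torusProj (v : Fin d → ℝ) : Torus d := WithLp.toLp 2 (fun i => (v i : UnitAddCircle))

theorem torusProj_surjective : Function.Surjective (torusProj (d := d)) := by
  intro x
  choose v hv using fun i => QuotientAddGroup.mk_surjective (x i)
  exact ⟨v, by ext i; exact hv i⟩

theorem torusProj_add_int (v : Fin d → ℝ) (p : Fin d → ℤ) :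
    torusProj (v + fun i => (p i : ℝ)) = torusProj v := by
  ext i
  simp [torusProj]

theorem dist_torusProj_apply (v w : Fin d → ℝ) (i : Fin d) :
    dist ((torusProj v) i) ((torusProj w) i) = ‖((v i - w i : ℝ) : UnitAddCircle)‖ := by
  rw [dist_eq_norm]; rfl

theorem dist_coord_le (x y : Torus d) (i : Fin d) : dist (x i) (y i) ≤ dist x y :=
  PiLp.dist_apply_le _ _ _

/-- The projection does not expand distances by more than `d`. -/
theorem dist_torusProj_le (v w : Fin d → ℝ) : dist (torusProj v) (torusProj w) ≤ d * ‖v - w‖ := by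
  rw [PiLp.dist_eq_of_L2]
  refine Real.sqrt_le_iff.2 ⟨by positivity, ?_⟩
  have h : ∀ i, dist ((torusProj v) i) ((torusProj w) i) ^ 2 ≤ ‖v - w‖ ^ 2 := by
    intro i
    rw [dist_torusProj_apply]
    have h1 : ‖((v i - w i : ℝ) : UnitAddCircle)‖ ≤ ‖v i - w i‖ :=
      QuotientAddGroup.norm_mk_le_norm
    gcongr
    exact h1.trans (norm_le_pi_norm (v - w) i)
  refine (Finset.sum_le_sum fun i _ => h i).trans ?_
  rw [Finset.sum_const, Finset.card_univ, Fintype.card_fin, nsmul_eq_mul, mul_pow]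
  gcongr
  exact_mod_cast Nat.le_self_pow two_ne_zero d

/-- Points of the torus have lifts that are no further apart than the points. -/
theorem exists_lift_near (v : Fin d → ℝ) (x : Torus d) :
    ∃ w, torusProj w = x ∧ ‖v - w‖ ≤ dist (torusProj v) x := by
  obtain ⟨w, rfl⟩ := torusProj_surjective x
  refine ⟨w + fun i => ((round (v i - w i) : ℤ) : ℝ), torusProj_add_int _ _, ?_⟩
  rw [pi_norm_le_iff_of_nonneg dist_nonneg]
  intro i
  refine le_trans (le_of_eq ?_) (dist_coord_le _ _ i)
  rw [dist_torusProj_apply, UnitAddCircle.norm_eq, Real.norm_eq_abs]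
  simp only [Pi.sub_apply, Pi.add_apply]
  ring_nf

/-- At distance at most `1 / 2`, the projection does not contract distances. -/
theorem norm_sub_le_dist_torusProj {v w : Fin d → ℝ} (h : ‖v - w‖ ≤ 1 / 2) :
    ‖v - w‖ ≤ dist (torusProj v) (torusProj w) := by
  rw [pi_norm_le_iff_of_nonneg dist_nonneg]
  intro i
  refine le_trans (le_of_eq ?_) (dist_coord_le _ _ i)
  rw [dist_torusProj_apply, (AddCircle.norm_coe_eq_abs_iff (p := (1 : ℝ)) one_ne_zero).2]
  · rfl
  · simpa using (norm_le_pi_norm (v - w) i).trans h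

theorem exists_int_add_norm_le (v : Fin d → ℝ) :
    ∃ (p : Fin d → ℤ) (r : Fin d → ℝ), v = r + (fun i => (p i : ℝ)) ∧ ‖r‖ ≤ 1 := by
  refine ⟨fun i => ⌊v i⌋, fun i => Int.fract (v i), ?_, ?_⟩
  · ext i; simp
  · rw [pi_norm_le_iff_of_nonneg zero_le_one]
    intro i
    rw [Real.norm_of_nonneg (Int.fract_nonneg _)]
    exact (Int.fract_lt_one _).le

theorem toralMap_torusProj (A : Matrix (Fin d) (Fin d) ℤ) (v : Fin d → ℝ) :
    toralMap A (torusProj v) = torusProj ((A.map (Int.cast : ℤ → ℝ)).mulVec v) := by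
  ext i
  simp only [toralMap, torusProj, Matrix.mulVec, dotProduct, Matrix.map_apply]
  have : ∀ (s : Finset (Fin d)) (g : Fin d → ℝ),
      ((∑ j ∈ s, g j : ℝ) : UnitAddCircle) = ∑ j ∈ s, (g j : UnitAddCircle) := fun s g =>
    map_sum (QuotientAddGroup.mk' _) g s
  rw [this]
  refine Finset.sum_congr rfl fun j _ => ?_
  rw [← zsmul_eq_mul]
  rfl

theorem toralMap_toralMap (A B : Matrix (Fin d) (Fin d) ℤ) (x : Torus d) :
    toralMap B (toralMap A x) = toralMap (B * A) x := by
  obtain ⟨v, rfl⟩ := torusProj_surjective x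
  rw [toralMap_torusProj, toralMap_torusProj, toralMap_torusProj, Matrix.mulVec_mulVec]
  congr 2
  exact (Matrix.map_mul (f := Int.castRingHom ℝ)).symm

theorem toralMap_one (x : Torus d) : toralMap (1 : Matrix (Fin d) (Fin d) ℤ) x = x := by
  obtain ⟨v, rfl⟩ := torusProj_surjective x
  rw [toralMap_torusProj, Matrix.map_one _ Int.cast_zero Int.cast_one, Matrix.one_mulVec]

theorem toralMap_injective (A : Matrix.SpecialLinearGroup (Fin d) ℤ) :
    Function.Injective (toralMap (A : Matrix (Fin d) (Fin d) ℤ)) := by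
  refine Function.LeftInverse.injective
    (g := toralMap ((A⁻¹ : Matrix.SpecialLinearGroup (Fin d) ℤ) : Matrix (Fin d) (Fin d) ℤ))
    fun x => ?_
  rw [toralMap_toralMap, ← Matrix.SpecialLinearGroup.coe_mul, inv_mul_cancel,
    Matrix.SpecialLinearGroup.coe_one, toralMap_one]

theorem toralMap_iterate_torusProj (A : Matrix (Fin d) (Fin d) ℤ) (n : ℕ)
    (v : Fin d → ℝ) : (toralMap A)^[n] (torusProj v) =
      torusProj (((A.map (Int.cast : ℤ → ℝ)) ^ n).mulVec v) := by
  induction n with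
  | zero => simp
  | succ n ih => rw [Function.iterate_succ_apply', ih, toralMap_torusProj, Matrix.mulVec_mulVec,
      pow_succ']

theorem exists_pow_mulVec_int (A : Matrix (Fin d) (Fin d) ℤ) (n : ℕ) (p : Fin d → ℤ) :
    ∃ q : Fin d → ℤ, ((A.map (Int.cast : ℤ → ℝ)) ^ n).mulVec (fun i => (p i : ℝ)) =
      fun i => (q i : ℝ) := by
  refine ⟨(A ^ n).mulVec p, ?_⟩
  have : (A.map (Int.cast : ℤ → ℝ)) ^ n = (A ^ n).map (Int.castRingHom ℝ) :=
    (map_pow (Int.castRingHom ℝ).mapMatrix A n).symm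
  rw [this]
  ext i
  exact ((Int.castRingHom ℝ).map_mulVec (A ^ n) p i).symm

end TorusProjection

/-! ### Stable and unstable coordinates on the torus. -/

namespace Splitting

variable {d m k : ℕ} {A : Matrix (Fin d) (Fin d) ℤ} {Ls Lu : ℝ} (σ : Splitting A Ls Lu m k)

theorem pow_apply_e (n : ℕ) (s : Fin m → ℝ) (u : Fin k → ℝ) :
    ((A.map (Int.cast : ℤ → ℝ)) ^ n).mulVec (σ.e (s, u)) =
      σ.e (((σ.S : (Fin m → ℝ) →L[ℝ] (Fin m → ℝ)) ^ n) s,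
        ((σ.U : (Fin k → ℝ) →L[ℝ] (Fin k → ℝ)) ^ n) u) := by
  induction n with
  | zero => simp
  | succ n ih =>
    rw [pow_succ', ← Matrix.mulVec_mulVec, ih, σ.apply_e, pow_succ', pow_succ']
    rfl

/-- Points of the torus, given by their stable and unstable coordinates. -/
def point (s : Fin m → ℝ) (u : Fin k → ℝ) : Torus d := torusProj (σ.e (s, u))

theorem iterate_point (n : ℕ) (s : Fin m → ℝ) (u : Fin k → ℝ) :
    (toralMap A)^[n] (σ.point s u) =
      σ.point (((σ.S : (Fin m → ℝ) →L[ℝ] (Fin m → ℝ)) ^ n) s)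
        (((σ.U : (Fin k → ℝ) →L[ℝ] (Fin k → ℝ)) ^ n) u) := by
  rw [point, toralMap_iterate_torusProj, pow_apply_e, point]

theorem S_pow_inv_pow (n : ℕ) (s : Fin m → ℝ) :
    ((σ.S : (Fin m → ℝ) →L[ℝ] (Fin m → ℝ)) ^ n)
      ((((σ.S⁻¹ : _ˣ) : (Fin m → ℝ) →L[ℝ] (Fin m → ℝ)) ^ n) s) = s := by
  rw [← mul_apply_eq_comp, ← Units.val_pow_eq_pow_val, ← Units.val_pow_eq_pow_val,
    ← Units.val_mul, inv_pow, mul_inv_cancel]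
  rfl

theorem U_pow_inv_pow (n : ℕ) (u : Fin k → ℝ) :
    ((σ.U : (Fin k → ℝ) →L[ℝ] (Fin k → ℝ)) ^ n)
      ((((σ.U⁻¹ : _ˣ) : (Fin k → ℝ) →L[ℝ] (Fin k → ℝ)) ^ n) u) = u := by
  rw [← mul_apply_eq_comp, ← Units.val_pow_eq_pow_val, ← Units.val_pow_eq_pow_val,
    ← Units.val_mul, inv_pow, mul_inv_cancel]
  rfl

theorem U_inv_pow_pow (n : ℕ) (u : Fin k → ℝ) :
    ((((σ.U⁻¹ : _ˣ) : (Fin k → ℝ) →L[ℝ] (Fin k → ℝ)) ^ n))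
      (((σ.U : (Fin k → ℝ) →L[ℝ] (Fin k → ℝ)) ^ n) u) = u := by
  rw [← mul_apply_eq_comp, ← Units.val_pow_eq_pow_val, ← Units.val_pow_eq_pow_val,
    ← Units.val_mul, inv_pow, inv_mul_cancel]
  rfl

/-- A bound for the inverse of the coordinates. -/
theorem exists_norm_le_norm_e : ∃ K : ℝ, 0 < K ∧ ∀ v, ‖v‖ ≤ K * ‖σ.e v‖ := by
  refine ⟨‖(σ.e.symm : (Fin d → ℝ) →L[ℝ] (Fin m → ℝ) × (Fin k → ℝ))‖ + 1, by positivity, fun v => ?_⟩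
  have := (σ.e.symm : (Fin d → ℝ) →L[ℝ] (Fin m → ℝ) × (Fin k → ℝ)).le_opNorm (σ.e v)
  simp only [ContinuousLinearEquiv.coe_coe, ContinuousLinearEquiv.symm_apply_apply] at this
  nlinarith [norm_nonneg (σ.e v)]

theorem dist_point_le (s s' : Fin m → ℝ) (u u' : Fin k → ℝ) :
    dist (σ.point s u) (σ.point s' u') ≤ d * (max ‖s - s'‖ ‖u - u'‖) := by
  refine (dist_torusProj_le _ _).trans ?_
  rw [← map_sub]
  have := σ.norm_e_le ((s, u) - (s', u'))
  have h2 : ‖((s, u) - (s', u') : (Fin m → ℝ) × (Fin k → ℝ))‖ = max ‖s - s'‖ ‖u - u'‖ := by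
    rw [Prod.mk_sub_mk, Prod.norm_mk]
  rw [h2] at this
  gcongr
  refine this.trans ?_
  have : 0 ≤ max ‖s - s'‖ ‖u - u'‖ := le_max_of_le_left (norm_nonneg _)
  linarith

end Splitting

/-! ### The Cantor construction. -/

section Cantor

open Filter Metric

/-- The digit of `y` in mixed radix, between the scales `M` and `M * q`. -/
def mixedDigit (M q : ℕ) (y : ℝ) : ℤ := ⌊((M * q : ℕ) : ℝ) * y⌋ - q * ⌊(M : ℝ) * y⌋

theorem mixedDigit_nonneg (M q : ℕ) (y : ℝ) : 0 ≤ mixedDigit M q y := by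
  rw [mixedDigit, sub_nonneg, Int.le_floor]
  push_cast
  have := Int.floor_le ((M : ℝ) * y)
  nlinarith [(Nat.cast_nonneg q : (0 : ℝ) ≤ q)]

theorem mixedDigit_lt {M q : ℕ} (hq : 0 < q) (y : ℝ) : mixedDigit M q y < q := by
  rw [mixedDigit, sub_lt_iff_lt_add, Int.floor_lt]
  push_cast
  have := Int.lt_floor_add_one ((M : ℝ) * y)
  have hq' : (0 : ℝ) < q := by exact_mod_cast hq
  nlinarith

theorem floor_eq_of_mixedDigit_eq {M q : ℕ} {y y' : ℝ}
    (h : ⌊(M : ℝ) * y⌋ = ⌊(M : ℝ) * y'⌋) (hd : mixedDigit M q y = mixedDigit M q y') :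
    ⌊((M * q : ℕ) : ℝ) * y⌋ = ⌊((M * q : ℕ) : ℝ) * y'⌋ := by
  rw [mixedDigit, mixedDigit, h] at hd
  linarith

/-- Applied at the first level where the digits of two points differ: their distance is then
controlled by the difference of the digits. -/
theorem mul_abs_sub_le_of_floor_eq {M q : ℕ} {y y' : ℝ}
    (h : ⌊(M : ℝ) * y⌋ = ⌊(M : ℝ) * y'⌋) :
    ((M * q : ℕ) : ℝ) * |y - y'| ≤ |((mixedDigit M q y - mixedDigit M q y' : ℤ) : ℝ)| + 1 := by
  have h1 : mixedDigit M q y - mixedDigit M q y' =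
      ⌊((M * q : ℕ) : ℝ) * y⌋ - ⌊((M * q : ℕ) : ℝ) * y'⌋ := by
    rw [mixedDigit, mixedDigit, h]; ring
  rw [h1]
  set P : ℝ := ((M * q : ℕ) : ℝ)
  have hP : 0 ≤ P := Nat.cast_nonneg _
  have e1 : P * |y - y'| = |P * y - P * y'| := by
    rw [← mul_sub, abs_mul, abs_of_nonneg hP]
  rw [e1]
  push_cast
  have a1 := Int.floor_le (P * y)
  have a2 := Int.lt_floor_add_one (P * y)
  have a3 := Int.floor_le (P * y')
  have a4 := Int.lt_floor_add_one (P * y')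
  rw [abs_le]
  constructor
  · linarith [neg_abs_le ((⌊P * y⌋ : ℝ) - ⌊P * y'⌋)]
  · linarith [le_abs_self ((⌊P * y⌋ : ℝ) - ⌊P * y'⌋)]

/-- Times at which a cube of radius `exp (-b * N)` splits into enough subcubes. -/
theorem exists_time_and_count {a b σ : ℝ} (hσb : 0 ≤ σ * b) (hσ : σ * b < a) {p : ℕ → Prop}
    (hp : ∃ᶠ n in atTop, p n) (N : ℕ) :
    ∃ n q : ℕ, N < n ∧ p n ∧ 16 * (q : ℝ) * Real.exp (-(a * n)) ≤ Real.exp (-(b * N)) ∧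
      Real.exp (σ * b * n) ≤ q := by
  have htend : Tendsto (fun n : ℕ => Real.exp ((a - σ * b) * n)) atTop atTop :=
    Real.tendsto_exp_atTop.comp
      (tendsto_natCast_atTop_atTop.const_mul_atTop (sub_pos.2 hσ))
  -- The factor 2 leaves room for rounding `exp (σ * b * n)`, which is at least 1, up to the integer
  -- `q`.
  have hev := (htend.eventually_ge_atTop (16 * (Real.exp (b * N) * 2))).and (eventually_gt_atTop N)
  obtain ⟨n, hpn, hn, hNn⟩ := (hp.and_eventually hev).exists
  set X : ℝ := Real.exp (-(b * N)) * Real.exp (a * n) / 16 with hX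
  have h1 : 2 * Real.exp (σ * b * n) ≤ X := by
    have : Real.exp (a * n) = Real.exp (σ * b * n) * Real.exp ((a - σ * b) * n) := by
      rw [← Real.exp_add]; ring_nf
    rw [hX, this]
    have h2 : Real.exp (-(b * N)) * Real.exp (b * N) = 1 := by rw [← Real.exp_add]; simp
    have h3 := mul_le_mul_of_nonneg_left hn
      (mul_pos (Real.exp_pos (-(b * N))) (Real.exp_pos (σ * b * n))).le
    have h4 : Real.exp (-(b * N)) * Real.exp (σ * b * n) * (16 * (Real.exp (b * N) * 2)) =
        32 * Real.exp (σ * b * n) * (Real.exp (-(b * N)) * Real.exp (b * N)) := by ring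
    rw [h4, h2] at h3
    linarith
  refine ⟨n, ⌈Real.exp (σ * b * n)⌉₊, hNn, hpn, ?_, Nat.le_ceil _⟩
  have h5 : 1 ≤ Real.exp (σ * b * n) := Real.one_le_exp (by positivity)
  have h6 : (⌈Real.exp (σ * b * n)⌉₊ : ℝ) ≤ X := by
    linarith [Nat.ceil_lt_add_one (Real.exp_pos (σ * b * n)).le]
  calc 16 * (⌈Real.exp (σ * b * n)⌉₊ : ℝ) * Real.exp (-(a * n))
      ≤ 16 * X * Real.exp (-(a * n)) := by gcongr
    _ = Real.exp (-(b * N)) * (Real.exp (a * n) * Real.exp (-(a * n))) := by rw [hX]; ring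
    _ = Real.exp (-(b * N)) := by rw [← Real.exp_add]; simp

/-- Nested cubes: if for each `i` there are infinitely many `n` such that every point is
`exp (-a * n)`-close to a point whose `exp (-b * n)`-neighbourhood is contained in `G i n`, then
there is a map from the unit cube into sets `⋂ G i (n i)` whose inverse is Hölder of exponent `σ`
for `σ < a / b`. -/
theorem exists_cantor_map {k : ℕ} {a b σ : ℝ} (ha : 0 < a) (hab : a ≤ b) (hσ0 : 0 < σ)
    (hσ1 : σ ≤ 1) (hσ : σ * b < a) (G : ℕ → ℕ → Set (Fin k → ℝ))
    (hG : ∀ i, ∃ᶠ n : ℕ in atTop, ∀ c, ∃ u, ‖u - c‖ ≤ Real.exp (-(a * n)) ∧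
      closedBall u (Real.exp (-(b * n))) ⊆ G i n) :
    ∃ (n : ℕ → ℕ) (x : (Fin k → ℝ) → (Fin k → ℝ)), StrictMono n ∧ (∀ y, ‖x y‖ ≤ 1) ∧
      (∀ y i, x y ∈ G i (n i)) ∧
      ∀ y y', (∀ l, y l ∈ Set.Ico (0 : ℝ) 1) → (∀ l, y' l ∈ Set.Ico (0 : ℝ) 1) →
        ‖y - y'‖ ≤ 16 * ‖x y - x y'‖ ^ σ := by
  have hb : 0 < b := ha.trans_le hab
  have hσb : 0 ≤ σ * b := by positivity
  choose nf qf hNn hgood hcell hcount using fun i N => exists_time_and_count hσb hσ (hG i) N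
  -- Starting from `n 0 = 0` makes the initial cube the unit ball. Each next time is so late that `q
  -- i` alone beats `exp (σ * b * n (i + 1))`, without help from the earlier factors of `M`.
  obtain ⟨n, hn0, hns⟩ : ∃ n : ℕ → ℕ, n 0 = 0 ∧ ∀ i, n (i + 1) = nf i (n i) :=
    ⟨fun i => Nat.rec 0 (fun i N => nf i N) i, rfl, fun _ => rfl⟩
  let q : ℕ → ℕ := fun i => qf i (n i)
  let M : ℕ → ℕ := fun i => ∏ j ∈ Finset.range i, q j
  have hMs : ∀ i, M (i + 1) = M i * q i := fun i => Finset.prod_range_succ _ _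
  let ρ : ℕ → ℝ := fun i => Real.exp (-(b * n i))
  have hρ : ∀ i, 0 < ρ i := fun i => Real.exp_pos _
  have hmono : StrictMono n := strictMono_nat_of_lt_succ fun i => (hns i).symm ▸ hNn i (n i)
  have hqexp : ∀ i, Real.exp (σ * b * n (i + 1)) ≤ q i := fun i => by
    rw [hns]; exact hcount i (n i)
  have hq : ∀ i, 0 < q i := fun i => by
    have := (Real.exp_pos _).trans_le (hqexp i)
    exact_mod_cast this
  have hqR : ∀ i, (1 : ℝ) ≤ q i := fun i => by exact_mod_cast hq i
  have hM : ∀ i, 0 < M i := fun i => Finset.prod_pos fun j _ => hq j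
  have hMexp : ∀ i, Real.exp (σ * b * n i) ≤ M i := by
    intro i
    cases i with
    | zero => simp [hn0, M]
    | succ i =>
      refine (hqexp i).trans ?_
      rw [hMs]
      exact_mod_cast Nat.le_mul_of_pos_left _ (hM i)
  have hgood' : ∀ i c, ∃ u, ‖u - c‖ ≤ Real.exp (-(a * n (i + 1))) ∧
      closedBall u (Real.exp (-(b * n (i + 1)))) ⊆ G i (n (i + 1)) := by
    intro i; rw [hns]; exact hgood i (n i)
  choose uf huf hufG using hgood'
  let dg : ℕ → (Fin k → ℝ) → (Fin k → ℝ) := fun i y l => ((mixedDigit (M i) (q i) (y l) : ℤ) : ℝ)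
  -- With this mesh the grid points, with digits 0, …, q - 1, stay within ρ / 2 of the centre, so
  -- the perturbed subcubes remain inside the cube.
  let g : ℕ → ℝ := fun i => ρ i / (2 * q i)
  have hg : ∀ i, 0 < g i := fun i => div_pos (hρ i) (by linarith [hqR i])
  have hgq : ∀ i, g i * q i = ρ i / 2 := fun i => by
    have := hqR i
    simp only [g]; field_simp
  let c : (Fin k → ℝ) → ℕ → (Fin k → ℝ) := fun y i =>
    Nat.rec 0 (fun i w => uf i (w + g i • dg i y)) i
  have hcs : ∀ y i, c y (i + 1) = uf i (c y i + g i • dg i y) := fun y i => rfl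
  have hag : ∀ i, Real.exp (-(a * n (i + 1))) ≤ g i / 8 := by
    intro i
    have h1 := hcell i (n i)
    have h2 := hqR i
    rw [← hns] at h1
    change 16 * (q i : ℝ) * Real.exp (-(a * n (i + 1))) ≤ ρ i at h1
    simp only [g]
    rw [div_div, le_div_iff₀ (by linarith)]
    linarith
  have hρg : ∀ i, ρ (i + 1) ≤ g i / 8 := by
    intro i
    refine le_trans ?_ (hag i)
    apply Real.exp_le_exp.2
    have : (0 : ℝ) ≤ n (i + 1) := Nat.cast_nonneg _
    nlinarith
  have hnear : ∀ y i, ‖c y (i + 1) - (c y i + g i • dg i y)‖ ≤ g i / 8 := fun y i =>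
    (huf i _).trans (hag i)
  have hdg : ∀ y i, ‖g i • dg i y‖ ≤ g i * (q i - 1) := by
    intro y i
    rw [norm_smul, Real.norm_of_nonneg (hg i).le]
    refine mul_le_mul_of_nonneg_left ?_ (hg i).le
    rw [pi_norm_le_iff_of_nonneg (by linarith [hqR i])]
    intro l
    have h1 := mixedDigit_nonneg (M i) (q i) (y l)
    have h2 := mixedDigit_lt (M := M i) (hq i) (y l)
    simp only [dg]
    rw [Real.norm_of_nonneg (by exact_mod_cast h1)]
    have : mixedDigit (M i) (q i) (y l) ≤ (q i : ℤ) - 1 := by omega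
    exact_mod_cast this
  have hsub : ∀ y i, closedBall (c y (i + 1)) (ρ (i + 1)) ⊆ closedBall (c y i) (ρ i) := by
    intro y i
    apply closedBall_subset_closedBall'
    rw [dist_eq_norm]
    have h1 : ‖c y (i + 1) - c y i‖ ≤ g i / 8 + g i * (q i - 1) := by
      have : c y (i + 1) - c y i = (c y (i + 1) - (c y i + g i • dg i y)) + g i • dg i y := by
        abel
      rw [this]
      exact (norm_add_le _ _).trans (add_le_add (hnear y i) (hdg y i))
    have := hρg i
    have := hgq i
    have := hg i
    have := hρ i
    linarith
  have hne : ∀ y, (⋂ i, closedBall (c y i) (ρ i)).Nonempty := fun y =>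
    IsCompact.nonempty_iInter_of_sequence_nonempty_isCompact_isClosed _ (hsub y)
      (fun i => nonempty_closedBall.2 (hρ i).le) (isCompact_closedBall _ _)
      (fun i => isClosed_closedBall)
  choose x hx using hne
  have hxi : ∀ y i, ‖x y - c y i‖ ≤ ρ i := fun y i => by
    have := Set.mem_iInter.1 (hx y) i
    rwa [mem_closedBall, dist_eq_norm] at this
  have hxg : ∀ y i, ‖x y - (c y i + g i • dg i y)‖ ≤ g i / 4 := by
    intro y i
    have : x y - (c y i + g i • dg i y) =
      (x y - c y (i + 1)) + (c y (i + 1) - (c y i + g i • dg i y)) := by abel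
    rw [this]
    refine (norm_add_le _ _).trans ?_
    linarith [hxi y (i + 1), hnear y i, hρg i]
  refine ⟨fun i => n (i + 1), x, fun i j h => hmono (by omega), fun y => ?_, fun y i => ?_, ?_⟩
  · have := hxi y 0
    simpa [c, ρ, hn0] using this
  · apply hufG i (c y i + g i • dg i y)
    have := Set.mem_iInter.1 (hx y) (i + 1)
    rwa [hcs] at this
  · intro y y' hy hy'
    have hfloor0 : ∀ l, ⌊((M 0 : ℕ) : ℝ) * y l⌋ = ⌊((M 0 : ℕ) : ℝ) * y' l⌋ := by
      intro l
      have h1 : ⌊y l⌋ = 0 := Int.floor_eq_zero_iff.2 (hy l)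
      have h2 : ⌊y' l⌋ = 0 := Int.floor_eq_zero_iff.2 (hy' l)
      simp [M, h1, h2]
    have hagree : ∀ i, (∀ j < i, dg j y = dg j y') →
        c y i = c y' i ∧ ∀ l, ⌊((M i : ℕ) : ℝ) * y l⌋ = ⌊((M i : ℕ) : ℝ) * y' l⌋ := by
      intro i
      induction i with
      | zero => exact fun _ => ⟨rfl, hfloor0⟩
      | succ i ih =>
        intro h
        obtain ⟨h1, h2⟩ := ih fun j hj => h j (by omega)
        have h3 := h i (by omega)
        refine ⟨by rw [hcs, hcs, h1, h3], fun l => ?_⟩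
        rw [hMs]
        exact floor_eq_of_mixedDigit_eq (h2 l) (Int.cast_injective (α := ℝ) (congrFun h3 l))
    by_cases hall : ∀ i, dg i y = dg i y'
    -- Equal digits at every level force equal points, because `M i` tends to infinity.
    · have hyy : y = y' := by
        ext l
        by_contra hne
        have hpos : 0 < |y l - y' l| := abs_pos.2 (sub_ne_zero.2 hne)
        have htend : Tendsto (fun i : ℕ => Real.exp (σ * b * n i)) atTop atTop :=
          Real.tendsto_exp_atTop.comp ((tendsto_natCast_atTop_atTop.comp
            hmono.tendsto_atTop).const_mul_atTop (by positivity))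
        obtain ⟨i, hi⟩ := (htend.eventually_gt_atTop (1 / |y l - y' l|)).exists
        have h1 := (hagree i fun j _ => hall j).2 l
        have h2 : ((M i : ℕ) : ℝ) * |y l - y' l| < 1 := by
          have := Int.abs_sub_lt_one_of_floor_eq_floor h1
          rwa [← mul_sub, abs_mul, abs_of_nonneg (Nat.cast_nonneg _)] at this
        have h3 := hi.trans_le (hMexp i)
        rw [div_lt_iff₀ hpos] at h3
        linarith
      rw [hyy, sub_self, norm_zero]
      positivity
    · push Not at hall
      classical
      let i := Nat.find hall
      have hi : dg i y ≠ dg i y' := Nat.find_spec hall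
      obtain ⟨hc, hfl⟩ := hagree i fun j hj => not_not.1 (Nat.find_min hall hj)
      set X := ‖x y - x y'‖ with hX
      set Δ := ‖dg i y - dg i y'‖ with hΔ
      have hcoord : ∀ l, |((mixedDigit (M i) (q i) (y l) - mixedDigit (M i) (q i) (y' l) : ℤ) : ℝ)|
          ≤ Δ := by
        intro l
        have := norm_le_pi_norm (dg i y - dg i y') l
        rw [Real.norm_eq_abs] at this
        push_cast
        exact this
      have hΔ1 : 1 ≤ Δ := by
        obtain ⟨l, hl⟩ := Function.ne_iff.1 hi
        refine le_trans ?_ (hcoord l)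
        have h1 : mixedDigit (M i) (q i) (y l) - mixedDigit (M i) (q i) (y' l) ≠ 0 := by
          intro h0
          exact hl (by simp only [dg]; rw [sub_eq_zero.1 h0])
        exact_mod_cast Int.one_le_abs h1
      have hMi : (0 : ℝ) < M i := by exact_mod_cast hM i
      have hqi : (0 : ℝ) < q i := by linarith [hqR i]
      have hyle : ‖y - y'‖ ≤ 2 * Δ / (M i * q i) := by
        rw [pi_norm_le_iff_of_nonneg (by positivity)]
        intro l
        rw [le_div_iff₀ (by positivity), mul_comm, Real.norm_eq_abs, Pi.sub_apply]
        have := mul_abs_sub_le_of_floor_eq (q := q i) (hfl l)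
        push_cast at this
        have h2 := hcoord l
        push_cast at h2
        linarith
      -- Each image is within g / 4 of its grid point; as Δ ≥ 1, the error g / 2 costs at most half
      -- of g Δ.
      have hgΔ : g i * Δ ≤ X + g i / 2 := by
        have h1 : g i • (dg i y - dg i y') = (x y - x y') - (x y - (c y i + g i • dg i y)) +
            (x y' - (c y' i + g i • dg i y')) := by
          rw [hc, smul_sub]; abel
        have h2 : g i * Δ = ‖g i • (dg i y - dg i y')‖ := by
          rw [norm_smul, Real.norm_of_nonneg (hg i).le]
        rw [h2, h1]
        refine (norm_add_le _ _).trans ?_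
        have := norm_sub_le (x y - x y') (x y - (c y i + g i • dg i y))
        linarith [hxg y i, hxg y' i]
      have hX0 : 0 < X := by nlinarith [hg i]
      have hgX : g i * Δ ≤ 2 * X := by nlinarith [hg i]
      have hX2 : X ≤ 2 * ρ i := by
        have h1 : x y - x y' = (x y - c y i) - (x y' - c y' i) := by rw [hc]; abel
        rw [hX, h1]
        linarith [norm_sub_le (x y - c y i) (x y' - c y' i), hxi y i, hxi y' i]
      have hMρ : ρ i ^ (-σ) ≤ M i := by
        refine le_trans (le_of_eq ?_) (hMexp i)
        simp only [ρ]
        rw [← Real.exp_mul]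
        ring_nf
      -- The bound is first linear in X with factor ρ ^ (σ - 1). Since X ≤ 2 ρ, the power X ^ (1 -
      -- σ) can be traded for ρ ^ (1 - σ), leaving X ^ σ.
      calc ‖y - y'‖ ≤ 2 * Δ / (M i * q i) := hyle
        _ = 4 * (g i * Δ) / (M i * ρ i) := by
          have := hρ i
          simp only [g]; field_simp; ring
        _ ≤ 4 * (2 * X) / (ρ i ^ (-σ) * ρ i) := by
          have := hρ i
          have := Real.rpow_pos_of_pos (hρ i) (-σ)
          gcongr
        _ = 8 * (X ^ σ * X ^ (1 - σ)) / ρ i ^ (1 - σ) := by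
          rw [← Real.rpow_add hX0, ← Real.rpow_add_one (hρ i).ne', add_sub_cancel, Real.rpow_one,
            neg_add_eq_sub]
          ring
        _ ≤ 8 * (X ^ σ * (2 * ρ i) ^ (1 - σ)) / ρ i ^ (1 - σ) := by
          have := hρ i
          gcongr
        _ = 8 * X ^ σ * 2 ^ (1 - σ) := by
          have := Real.rpow_pos_of_pos (hρ i) (1 - σ)
          rw [Real.mul_rpow (by norm_num) (hρ i).le]
          field_simp
        _ ≤ 8 * X ^ σ * 2 ^ (1 : ℝ) := by
          gcongr
          · norm_num
          · linarith
        _ = 16 * X ^ σ := by rw [Real.rpow_one]; ring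

end Cantor

/-! ### Hitting a small target from near every unstable coordinate. -/

section

open Filter Topology

theorem eventually_mul_exp_lt {c c' : ℝ} (h : c < c') (C : ℝ) :
    ∀ᶠ n : ℕ in atTop, C * Real.exp (c * n) < Real.exp (c' * n) := by
  have htend : Tendsto (fun n : ℕ => Real.exp ((c' - c) * n)) atTop atTop :=
    Real.tendsto_exp_atTop.comp
      (tendsto_natCast_atTop_atTop.const_mul_atTop (sub_pos.2 h))
  filter_upwards [htend.eventually_gt_atTop C] with n hn
  have : Real.exp (c' * n) = Real.exp ((c' - c) * n) * Real.exp (c * n) := by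
    rw [← Real.exp_add]; ring_nf
  rw [this]
  gcongr

theorem GrowthAtMost.exists_norm_apply_le {V : Type*} [NormedAddCommGroup V] [NormedSpace ℝ V]
    {T : V →L[ℝ] V} {L : ℝ} (h : GrowthAtMost T L) {ε : ℝ} (hε : 0 < ε) :
    ∃ C : ℝ, 0 < C ∧ ∀ (n : ℕ) (v : V), ‖(T ^ n) v‖ ≤ C * Real.exp ((L + ε) * n) * ‖v‖ := by
  obtain ⟨C, hC, h⟩ := h ε hε
  exact ⟨C, hC, fun n v => (T ^ n).le_of_opNorm_le (h n) v⟩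

namespace Splitting

variable {d m k : ℕ} {A : Matrix (Fin d) (Fin d) ℤ} {Ls Lu : ℝ} (σ : Splitting A Ls Lu m k)

/-- Every point of `ℝᵈ` is an integer vector away from the image under `A ^ j` of a bounded set. -/
theorem exists_eq_int_add_pow_apply {K : ℝ} (hK : ∀ v, ‖v‖ ≤ K * ‖σ.e v‖) (hK0 : 0 < K)
    (j : ℕ) (y : Fin d → ℝ) :
    ∃ (q : Fin d → ℤ) (s : Fin m → ℝ) (u : Fin k → ℝ), ‖s‖ ≤ K ∧ ‖u‖ ≤ K ∧
      y = σ.e (((σ.S : (Fin m → ℝ) →L[ℝ] (Fin m → ℝ)) ^ j) s,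
        ((σ.U : (Fin k → ℝ) →L[ℝ] (Fin k → ℝ)) ^ j) u) + fun i => (q i : ℝ) := by
  set w := σ.e.symm y with hw
  have hy : y = σ.e (w.1, w.2) := by simp [hw]
  -- Pull y back by A^j, split off an integer vector, and push forward again: A^j maps integer
  -- vectors to integer vectors.
  obtain ⟨p, r, hpr, hr⟩ := exists_int_add_norm_le
    (σ.e ((((σ.S⁻¹ : _ˣ) : (Fin m → ℝ) →L[ℝ] (Fin m → ℝ)) ^ j) w.1,
      (((σ.U⁻¹ : _ˣ) : (Fin k → ℝ) →L[ℝ] (Fin k → ℝ)) ^ j) w.2))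
  obtain ⟨q, hq⟩ := exists_pow_mulVec_int A j p
  set v := σ.e.symm r with hv
  have hvr : r = σ.e (v.1, v.2) := by simp [hv]
  have hvK : ‖v‖ ≤ K := by
    refine (hK v).trans ?_
    rw [hv, ContinuousLinearEquiv.apply_symm_apply]
    nlinarith
  refine ⟨q, v.1, v.2, (norm_fst_le v).trans hvK, (norm_snd_le v).trans hvK, ?_⟩
  have := congrArg (((A.map (Int.cast : ℤ → ℝ)) ^ j).mulVec) hpr
  rw [Matrix.mulVec_add, hq, hvr, pow_apply_e, pow_apply_e, S_pow_inv_pow, U_pow_inv_pow,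
    ← hy] at this
  exact this

/-- Near every unstable coordinate there is a small ball of unstable coordinates whose points,
with any bounded stable coordinate, hit a given exponentially small target at a given late time. -/
theorem eventually_exists_ball_hits (hLu : 0 < Lu) {t a b : ℝ} (ht : 0 < t)
    (htLs : t < Ls) (ha : a < Lu * (1 - t / Ls)) (hb : Lu + t < b) :
    ∀ᶠ n : ℕ in atTop, ∀ (z : Torus d) (c : Fin k → ℝ), ∃ u, ‖u - c‖ ≤ Real.exp (-(a * n)) ∧
      ∀ u' ∈ Metric.closedBall u (Real.exp (-(b * n))), ∀ s : Fin m → ℝ, ‖s‖ ≤ 1 →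
        dist ((toralMap A)^[n] (σ.point s u')) z < Real.exp (-(t * n)) := by
  obtain ⟨ε, hε0, hεa, hεb, hεs⟩ : ∃ ε : ℝ, 0 < ε ∧
      a < (Lu - ε) - (Lu + ε) * ((t + ε) / (Ls - ε)) ∧ ε < b - (Lu + t) ∧ ε < Ls - t := by
    have h1 : ∀ᶠ ε in 𝓝[>] (0 : ℝ), a < (Lu - ε) - (Lu + ε) * ((t + ε) / (Ls - ε)) := by
      have hcont : ContinuousAt (fun ε : ℝ => (Lu - ε) - (Lu + ε) * ((t + ε) / (Ls - ε))) 0 := by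
        have : Ls - 0 ≠ 0 := by linarith
        fun_prop (disch := assumption)
      refine nhdsWithin_le_nhds (hcont.eventually_const_lt ?_)
      simp only [sub_zero, add_zero]
      linarith
    have h2 : ∀ᶠ ε in 𝓝[>] (0 : ℝ), ε < b - (Lu + t) :=
      nhdsWithin_le_nhds (eventually_lt_nhds (by linarith))
    have h3 : ∀ᶠ ε in 𝓝[>] (0 : ℝ), ε < Ls - t :=
      nhdsWithin_le_nhds (eventually_lt_nhds (by linarith))
    obtain ⟨ε, h⟩ := (eventually_mem_nhdsWithin.and (h1.and (h2.and h3))).exists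
    exact ⟨ε, h⟩
  obtain ⟨C₁, hC₁, hU'⟩ := σ.growth_U_inv.exists_norm_apply_le hε0
  obtain ⟨C₂, hC₂, hU⟩ := σ.growth_U.exists_norm_apply_le hε0
  obtain ⟨C₃, hC₃, hS⟩ := σ.growth_S.exists_norm_apply_le hε0
  obtain ⟨K, hK0, hK⟩ := σ.exists_norm_le_norm_e
  have hLsε : 0 < Ls - ε := by linarith
  -- With j ≥ α n, the stable contraction over j steps at the pessimistic rate Ls - ε is at least by
  -- the factor `exp (-(t + ε) * n)`.
  set α := (t + ε) / (Ls - ε) with hα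
  have hα0 : 0 < α := by positivity
  filter_upwards [eventually_mul_exp_lt
      (show (-Lu + ε) + (Lu + ε) * α < -a by linarith) (C₁ * (C₂ * Real.exp (Lu + ε) * K)),
    eventually_mul_exp_lt (show -Ls + ε < -t by linarith) (3 * d * C₃),
    eventually_mul_exp_lt (show -(t + ε) < -t by linarith) (3 * d * (C₃ * K)),
    eventually_mul_exp_lt (show Lu + ε - b < -t by linarith) (3 * d * C₂)] with n h1 h2 h3 h4 z c
  obtain ⟨zl, rfl⟩ := torusProj_surjective z
  set j := ⌈α * n⌉₊ with hj
  have hj1 : α * n ≤ j := Nat.le_ceil _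
  have hj2 : (j : ℝ) < α * n + 1 := Nat.ceil_lt_add_one (by positivity)
  obtain ⟨q, s₀, u₀, hs₀, hu₀, hy⟩ := σ.exists_eq_int_add_pow_apply hK hK0 j
    (zl - ((A.map (Int.cast : ℤ → ℝ)) ^ n).mulVec (σ.e (0, c)))
  set w := ((σ.U : (Fin k → ℝ) →L[ℝ] (Fin k → ℝ)) ^ j) u₀ with hw
  set s₁ := ((σ.S : (Fin m → ℝ) →L[ℝ] (Fin m → ℝ)) ^ j) s₀ with hs₁
  -- The correction moves the n-th image by exactly `w`, so that modulo integers only the small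
  -- stable error `s₁` separates it from the target.
  refine ⟨c + (((σ.U⁻¹ : _ˣ) : (Fin k → ℝ) →L[ℝ] (Fin k → ℝ)) ^ n) w, ?_, ?_⟩
  · rw [add_sub_cancel_left]
    have e1 : ‖w‖ ≤ C₂ * Real.exp (Lu + ε) * K * Real.exp ((Lu + ε) * α * n) := by
      refine (hU j u₀).trans ?_
      calc C₂ * Real.exp ((Lu + ε) * j) * ‖u₀‖
          ≤ C₂ * Real.exp ((Lu + ε) * (α * n + 1)) * K := by gcongr
        _ = _ := by
          rw [mul_add, Real.exp_add]; ring_nf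
    refine (hU' n w).trans (le_trans ?_ (h1.le.trans (le_of_eq (by ring_nf))))
    calc C₁ * Real.exp ((-Lu + ε) * n) * ‖w‖
        ≤ C₁ * Real.exp ((-Lu + ε) * n) *
          (C₂ * Real.exp (Lu + ε) * K * Real.exp ((Lu + ε) * α * n)) := by gcongr
      _ = C₁ * (C₂ * Real.exp (Lu + ε) * K) *
          (Real.exp ((-Lu + ε) * n) * Real.exp ((Lu + ε) * α * n)) := by ring
      _ = _ := by rw [← Real.exp_add]; ring_nf
  · intro u' hu' s hs
    rw [Metric.mem_closedBall, dist_eq_norm] at hu'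
    set u := c + (((σ.U⁻¹ : _ˣ) : (Fin k → ℝ) →L[ℝ] (Fin k → ℝ)) ^ n) w with hu
    have hz : torusProj zl = torusProj (zl + fun i => ((-q i : ℤ) : ℝ)) :=
      (torusProj_add_int _ _).symm
    have hUu : ((σ.U : (Fin k → ℝ) →L[ℝ] (Fin k → ℝ)) ^ n) u =
        ((σ.U : (Fin k → ℝ) →L[ℝ] (Fin k → ℝ)) ^ n) c + w := by
      rw [hu, map_add, U_pow_inv_pow]
    have hdiff : σ.e (((σ.S : (Fin m → ℝ) →L[ℝ] (Fin m → ℝ)) ^ n) s,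
        ((σ.U : (Fin k → ℝ) →L[ℝ] (Fin k → ℝ)) ^ n) u') - (zl + fun i => ((-q i : ℤ) : ℝ)) =
        σ.e (((σ.S : (Fin m → ℝ) →L[ℝ] (Fin m → ℝ)) ^ n) s - s₁,
          ((σ.U : (Fin k → ℝ) →L[ℝ] (Fin k → ℝ)) ^ n) (u' - u)) := by
      have hzl : zl = σ.e (0, ((σ.U : (Fin k → ℝ) →L[ℝ] (Fin k → ℝ)) ^ n) c) + σ.e (s₁, w) +
          fun i => (q i : ℝ) := by
        rw [pow_apply_e, map_zero] at hy
        rw [add_assoc, ← hy]; abel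
      have hq : (fun i => ((-q i : ℤ) : ℝ)) = -fun i => (q i : ℝ) := by
        ext i; simp
      rw [hzl, hq, add_neg_cancel_right, ← map_add, ← map_sub, Prod.mk_add_mk, Prod.mk_sub_mk,
        zero_add, map_sub, hUu]
    rw [iterate_point, hz, point]
    refine (dist_torusProj_le _ _).trans_lt ?_
    rw [hdiff]
    have b1 : ‖((σ.S : (Fin m → ℝ) →L[ℝ] (Fin m → ℝ)) ^ n) s‖ ≤ C₃ * Real.exp ((-Ls + ε) * n) := by
      refine (hS n s).trans (mul_le_of_le_one_right (by positivity) hs)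
    have b2 : ‖s₁‖ ≤ C₃ * K * Real.exp (-(t + ε) * n) := by
      refine (hS j s₀).trans ?_
      have : (-Ls + ε) * j ≤ -(t + ε) * n := by
        have : (t + ε) = α * (Ls - ε) := by rw [hα]; field_simp
        rw [this]
        nlinarith
      calc C₃ * Real.exp ((-Ls + ε) * j) * ‖s₀‖ ≤ C₃ * Real.exp (-(t + ε) * n) * K := by gcongr
        _ = _ := by ring
    have b3 : ‖((σ.U : (Fin k → ℝ) →L[ℝ] (Fin k → ℝ)) ^ n) (u' - u)‖ ≤
        C₂ * Real.exp ((Lu + ε - b) * n) := by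
      refine (hU n _).trans ?_
      calc C₂ * Real.exp ((Lu + ε) * n) * ‖u' - u‖
          ≤ C₂ * Real.exp ((Lu + ε) * n) * Real.exp (-(b * n)) := by gcongr
        _ = _ := by rw [mul_assoc, ← Real.exp_add]; ring_nf
    have b4 : ‖σ.e (((σ.S : (Fin m → ℝ) →L[ℝ] (Fin m → ℝ)) ^ n) s - s₁,
          ((σ.U : (Fin k → ℝ) →L[ℝ] (Fin k → ℝ)) ^ n) (u' - u))‖ ≤
        C₃ * Real.exp ((-Ls + ε) * n) + C₃ * K * Real.exp (-(t + ε) * n) +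
          C₂ * Real.exp ((Lu + ε - b) * n) := by
      refine (σ.norm_e_le _).trans ?_
      rw [Prod.norm_mk]
      have := norm_sub_le (((σ.S : (Fin m → ℝ) →L[ℝ] (Fin m → ℝ)) ^ n) s) s₁
      have hnn := norm_nonneg (((σ.U : (Fin k → ℝ) →L[ℝ] (Fin k → ℝ)) ^ n) (u' - u))
      have hnn' := norm_nonneg (((σ.S : (Fin m → ℝ) →L[ℝ] (Fin m → ℝ)) ^ n) s - s₁)
      have hmax := max_le_add_of_nonneg hnn' hnn
      linarith
    have e0 : Real.exp (-(t * n)) = Real.exp (-t * n) := by ring_nf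
    rw [e0]
    have b5 := mul_le_mul_of_nonneg_left b4 (Nat.cast_nonneg d : (0 : ℝ) ≤ d)
    linarith

end Splitting

end

/-! ### Mass distribution and the lower bounds. -/

section

open Filter Topology MeasureTheory Metric

section MassDistribution

variable {X Y : Type*} [MetricSpace X] [MeasurableSpace Y]

/-- Mass distribution principle for the Hausdorff dimension, for an outer measure transported by
an arbitrary map. -/
theorem le_dimH_of_measure_preimage_le (μ : Measure Y) {F : Y → X} {S : Set Y} (hS : μ S ≠ 0)
    {E : Set X} (hE : ∀ y ∈ S, F y ∈ E) {s C : ℝ≥0}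
    (h : ∀ U : Set X, μ (S ∩ F ⁻¹' U) ≤ C * ediam U ^ (s : ℝ)) : (s : ℝ≥0∞) ≤ dimH E := by
  borelize X
  apply le_dimH_of_hausdorffMeasure_ne_zero
  have key : μ S / C ≤ Measure.hausdorffMeasure (s : ℝ) E := by
    rw [Measure.hausdorffMeasure_apply]
    refine le_trans ?_ (le_iSup₂ (1 : ℝ≥0∞) one_pos)
    refine le_iInf fun t => le_iInf fun ht => le_iInf fun _ => ?_
    refine ENNReal.div_le_of_le_mul' ?_
    rw [← ENNReal.tsum_mul_left]
    -- Only monotonicity and countable subadditivity are used, so `F` need not be measurable; this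
    -- matters because the Cantor map comes from choice.
    have hcov : S ⊆ ⋃ n, S ∩ F ⁻¹' t n := fun y hy => by
      obtain ⟨n, hn⟩ := Set.mem_iUnion.1 (ht (hE y hy))
      exact Set.mem_iUnion.2 ⟨n, hy, hn⟩
    refine (measure_mono hcov).trans ((measure_iUnion_le _).trans (ENNReal.tsum_le_tsum fun n => ?_))
    rcases (t n).eq_empty_or_nonempty with h0 | h0
    · simp [h0]
    · simpa [h0] using h (t n)
  intro h0
  rw [h0, nonpos_iff_eq_zero, ENNReal.div_eq_zero_iff] at key
  rcases key with h1 | h1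
  · exact hS h1
  · exact ENNReal.coe_ne_top h1

/-- Mass distribution principle for the Bowen entropy. -/
theorem le_bowenEntropyAt_of_measure_preimage_le (f : X → X) {ε : ℝ} (μ : Measure Y) {F : Y → X}
    {S : Set Y} (hS : μ S ≠ 0) {E : Set X} (hE : ∀ y ∈ S, F y ∈ E) {s C : ℝ≥0}
    (h : ∀ (n : ℕ) (x : X), 1 ≤ n → μ (S ∩ F ⁻¹' bowenBall f n x ε) ≤
      C * ENNReal.ofReal (Real.exp (-(s * n)))) : (s : ℝ≥0∞) ≤ bowenEntropyAt f ε E := by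
  refine le_iInf₂ fun s' hs' => ?_
  by_contra hlt
  have hlt : s' < s := by exact_mod_cast not_le.1 hlt
  -- N = 1 suffices, since the measure is a supremum over N, and it excludes Bowen balls of length
  -- 0, which are the whole space.
  have key : μ S / C ≤ bowenPreMeasure f s' 1 ε E := by
    refine le_iInf fun t => le_iInf fun htc => le_iInf fun ht1 => le_iInf fun ht => ?_
    refine ENNReal.div_le_of_le_mul' ?_
    rw [← ENNReal.tsum_mul_left]
    have hcov : S ⊆ ⋃ p ∈ t, S ∩ F ⁻¹' bowenBall f p.2 p.1 ε := fun y hy => by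
      obtain ⟨p, hp, hy'⟩ := Set.mem_iUnion₂.1 (ht (hE y hy))
      exact Set.mem_iUnion₂.2 ⟨p, hp, hy, hy'⟩
    refine (measure_mono hcov).trans ((measure_biUnion_le _ htc _).trans
      (ENNReal.tsum_le_tsum fun p => (h _ _ (ht1 _ p.2)).trans ?_))
    gcongr
  have hle : bowenPreMeasure f s' 1 ε E ≤ bowenMeasure f s' ε E :=
    le_iSup (fun N => bowenPreMeasure f s' N ε E) 1
  rw [hs'] at hle
  have h0 := key.trans hle
  rw [nonpos_iff_eq_zero, ENNReal.div_eq_zero_iff] at h0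
  rcases h0 with h1 | h1
  · exact hS h1
  · exact ENNReal.coe_ne_top h1

end MassDistribution

/-- The half-open unit cube. -/
def unitCube (k : ℕ) : Set (Fin k → ℝ) := Set.univ.pi fun _ => Set.Ico (0 : ℝ) 1

theorem volume_unitCube (k : ℕ) : volume (unitCube k) = 1 := by
  simp [unitCube, Real.volume_pi_Ico]

theorem mem_unitCube {k : ℕ} {y : Fin k → ℝ} : y ∈ unitCube k ↔ ∀ l, y l ∈ Set.Ico (0 : ℝ) 1 := by
  simp [unitCube]

namespace Splitting

variable {d m k : ℕ} {A : Matrix (Fin d) (Fin d) ℤ} {Ls Lu : ℝ} (σ : Splitting A Ls Lu m k)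

/-- Points of the unit balls differ by at most 2, so `e` takes the difference to norm at most 1 / 4,
within the scale at which the torus projection does not contract. -/
theorem norm_le_dist_point {K : ℝ} (hK : ∀ v, ‖v‖ ≤ K * ‖σ.e v‖) (hK0 : 0 < K)
    {s s' : Fin m → ℝ} {u u' : Fin k → ℝ} (hs : ‖s‖ ≤ 1) (hs' : ‖s'‖ ≤ 1) (hu : ‖u‖ ≤ 1)
    (hu' : ‖u'‖ ≤ 1) :
    ‖s - s'‖ ≤ K * dist (σ.point s u) (σ.point s' u') ∧
      ‖u - u'‖ ≤ K * dist (σ.point s u) (σ.point s' u') := by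
  set v : (Fin m → ℝ) × (Fin k → ℝ) := (s - s', u - u') with hv
  have hve : σ.e v = σ.e (s, u) - σ.e (s', u') := by rw [← map_sub, Prod.mk_sub_mk]
  have hv2 : ‖v‖ ≤ 2 := by
    rw [hv, Prod.norm_mk]
    exact max_le ((norm_sub_le _ _).trans (by linarith)) ((norm_sub_le _ _).trans (by linarith))
  have h1 : ‖σ.e v‖ ≤ dist (σ.point s u) (σ.point s' u') := by
    rw [hve]
    apply norm_sub_le_dist_torusProj
    rw [← hve]
    linarith [σ.norm_e_le v]
  have h2 : ‖v‖ ≤ K * dist (σ.point s u) (σ.point s' u') := (hK v).trans (by gcongr)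
  exact ⟨(norm_fst_le v).trans h2, (norm_snd_le v).trans h2⟩

/-- A set that contains the stable leaves through a Cantor set with `θ`-Hölder inverse
parametrization has dimension at least `m + θ * k`. -/
theorem le_dimH_of_holder_inverse (hm : 0 < m) {θ : ℝ} (hθ : 0 < θ)
    {x : (Fin k → ℝ) → (Fin k → ℝ)} (hx1 : ∀ y, ‖x y‖ ≤ 1)
    (hx : ∀ y ∈ unitCube k, ∀ y' ∈ unitCube k, ‖y - y'‖ ≤ 16 * ‖x y - x y'‖ ^ θ)
    {E : Set (Torus d)} (hE : ∀ s y, ‖s‖ ≤ 1 → σ.point s (x y) ∈ E) :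
    ENNReal.ofReal (m + θ * k) ≤ dimH E := by
  obtain ⟨K, hK0, hK⟩ := σ.exists_norm_le_norm_e
  set S : Set ((Fin m → ℝ) × (Fin k → ℝ)) := closedBall 0 1 ×ˢ unitCube k with hS
  set C : ℝ := (2 * K) ^ m * (32 * K ^ θ) ^ k with hC
  have hCpos : 0 < C := by positivity
  have hexp : 0 < (m : ℝ) + θ * k := by positivity
  have hSne : volume S ≠ 0 := by
    rw [hS, Measure.volume_eq_prod, Measure.prod_prod, volume_unitCube, mul_one]
    exact (measure_closedBall_pos volume 0 one_pos).ne'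
  refine le_dimH_of_measure_preimage_le (X := Torus d) volume (S := S)
    (F := fun p => σ.point p.1 (x p.2))
    (s := ((m : ℝ) + θ * k).toNNReal) (C := C.toNNReal) hSne ?_ ?_
  · rintro ⟨s, y⟩ ⟨hs, _⟩
    exact hE s y (by simpa using hs)
  · intro V
    rw [Real.coe_toNNReal _ hexp.le]
    by_cases hV : ediam V = ⊤
    · rw [hV, ENNReal.top_rpow_of_pos hexp, ENNReal.mul_top]
      · exact le_top
      · simpa using hCpos
    rcases (S ∩ (fun p => σ.point p.1 (x p.2)) ⁻¹' V).eq_empty_or_nonempty with h0 | ⟨⟨s₀, y₀⟩, h0⟩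
    · rw [h0]; simp
    set δ := diam V with hδ
    have hδ0 : 0 ≤ δ := diam_nonneg
    have hsub : S ∩ (fun p => σ.point p.1 (x p.2)) ⁻¹' V ⊆
        closedBall s₀ (K * δ) ×ˢ closedBall y₀ (16 * (K * δ) ^ θ) := by
      rintro ⟨s, y⟩ ⟨⟨hs, hy⟩, hV'⟩
      obtain ⟨⟨hs₀, hy₀⟩, hV₀⟩ := h0
      have hd : dist (σ.point s (x y)) (σ.point s₀ (x y₀)) ≤ δ :=
        dist_le_diam_of_mem' hV hV' hV₀
      obtain ⟨h1, h2⟩ := σ.norm_le_dist_point hK hK0 (s := s) (s' := s₀) (u := x y) (u' := x y₀)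
        (by simpa using hs) (by simpa using hs₀) (hx1 _) (hx1 _)
      have h1' : ‖s - s₀‖ ≤ K * δ := h1.trans (by gcongr)
      have h2' : ‖x y - x y₀‖ ≤ K * δ := h2.trans (by gcongr)
      refine ⟨by simpa [dist_eq_norm] using h1', ?_⟩
      rw [mem_closedBall, dist_eq_norm]
      refine (hx y hy y₀ hy₀).trans ?_
      gcongr
    refine (measure_mono hsub).trans ?_
    rw [Measure.volume_eq_prod, Measure.prod_prod, Real.volume_pi_closedBall _ (by positivity),
      Real.volume_pi_closedBall _ (by positivity), Fintype.card_fin, Fintype.card_fin,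
      ← ENNReal.ofReal_mul (by positivity)]
    have hd : ediam V = ENNReal.ofReal δ := (ENNReal.ofReal_toReal hV).symm
    rw [hd, ENNReal.ofReal_rpow_of_nonneg hδ0 hexp.le]
    change _ ≤ ENNReal.ofReal C * _
    rw [← ENNReal.ofReal_mul hCpos.le]
    apply ENNReal.ofReal_le_ofReal
    apply le_of_eq
    have e1 : δ ^ ((m : ℝ) + θ * k) = δ ^ m * (δ ^ θ) ^ k := by
      rw [Real.rpow_add_of_nonneg hδ0 (by positivity) (by positivity), Real.rpow_natCast,
        Real.rpow_mul hδ0, Real.rpow_natCast]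
    rw [e1, hC, Real.mul_rpow hK0.le hδ0]
    ring

/-- Bowen balls along an unstable leaf are exponentially small. -/
theorem exists_norm_le_of_bowenBall {ε : ℝ} (hε : 0 < ε) :
    ∃ r C : ℝ, 0 < r ∧ 0 < C ∧ ∀ (n : ℕ) (p : Torus d) (u u' : Fin k → ℝ), 1 ≤ n → ‖u‖ ≤ 1 →
      ‖u'‖ ≤ 1 → σ.point 0 u ∈ bowenBall (toralMap A) n p r →
      σ.point 0 u' ∈ bowenBall (toralMap A) n p r →
      ‖u - u'‖ ≤ C * Real.exp (-((Lu - ε) * n)) := by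
  obtain ⟨K, hK0, hK⟩ := σ.exists_norm_le_norm_e
  obtain ⟨C₁, hC₁, hU'⟩ := σ.growth_U_inv.exists_norm_apply_le hε
  set U : (Fin k → ℝ) →L[ℝ] (Fin k → ℝ) := σ.U.val with hU
  -- `H` bounds the expansion of one step. The Bowen radius 1 / (4H) is chosen so that two points of
  -- a ball, at most 1 / (2H) apart, are still within 1 / 2 after one more step.
  set H : ℝ := ‖U‖ * K + 1 with hH
  have hH0 : 1 ≤ H := le_add_of_nonneg_left (by positivity)
  have hstep : ∀ v : Fin k → ℝ, ‖σ.e (0, U v)‖ ≤ H * ‖σ.e (0, v)‖ := by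
    intro v
    have h1 := σ.norm_e_le (0, U v)
    have h2 := hK (0, v)
    rw [Prod.norm_mk, norm_zero, max_eq_right (norm_nonneg _)] at h1 h2
    have h3 := U.le_opNorm v
    have h4 := mul_le_mul_of_nonneg_left h2 (norm_nonneg U)
    nlinarith [norm_nonneg (U v), norm_nonneg (σ.e (0, v))]
  refine ⟨1 / (4 * H), C₁ * (K * (1 / 2)) * Real.exp (Lu - ε), by positivity, by positivity,
    fun n p u u' hn hu hu' hp hp' => ?_⟩
  have hr : H * (1 / (4 * H) + 1 / (4 * H)) = 1 / 2 := by field_simp; norm_num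
  have hdist : ∀ i < n, dist (σ.point 0 ((U ^ i) u)) (σ.point 0 ((U ^ i) u')) ≤
      1 / (4 * H) + 1 / (4 * H) := by
    intro i hi
    have h1 := hp i hi
    have h2 := hp' i hi
    rw [iterate_point, map_zero] at h1 h2
    rw [dist_comm] at h1
    exact (dist_triangle _ _ _).trans (add_le_add h1.le h2.le)
  have hpt : ∀ i, ‖σ.e (0, (U ^ i) (u - u'))‖ ≤ 1 / 2 →
      ‖σ.e (0, (U ^ i) (u - u'))‖ ≤ dist (σ.point 0 ((U ^ i) u)) (σ.point 0 ((U ^ i) u')) := by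
    intro i hi
    have : σ.e (0, (U ^ i) (u - u')) = σ.e (0, (U ^ i) u) - σ.e (0, (U ^ i) u') := by
      rw [← map_sub, Prod.mk_sub_mk, sub_zero, map_sub]
    rw [this] at hi ⊢
    exact norm_sub_le_dist_torusProj hi
  -- Induction on time: smallness at step i keeps the lifted displacement at step i + 1 within 1 /
  -- 2, where torus distance controls it, and the Bowen ball makes it small again.
  have hall : ∀ i < n, ‖σ.e (0, (U ^ i) (u - u'))‖ ≤ 1 / (4 * H) + 1 / (4 * H) := by
    intro i
    induction i with
    | zero =>
      intro hi
      refine (hpt 0 ?_).trans (hdist 0 hi)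
      have h1 := σ.norm_e_le (0, (U ^ 0) (u - u'))
      rw [Prod.norm_mk, norm_zero, max_eq_right (norm_nonneg _)] at h1
      have h2 : ‖(U ^ 0) (u - u')‖ ≤ 2 := by
        simpa using (norm_sub_le u u').trans (by linarith)
      linarith
    | succ i ih =>
      intro hi
      refine (hpt (i + 1) ?_).trans (hdist (i + 1) hi)
      have h1 := hstep ((U ^ i) (u - u'))
      have h2 := ih (by omega)
      rw [pow_succ']
      refine h1.trans ?_
      rw [← hr]
      gcongr
  obtain ⟨j, rfl⟩ : ∃ j, n = j + 1 := ⟨n - 1, by omega⟩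
  have h1 : ‖(U ^ j) (u - u')‖ ≤ K * (1 / 2) := by
    have h2 := hK (0, (U ^ j) (u - u'))
    rw [Prod.norm_mk, norm_zero, max_eq_right (norm_nonneg _)] at h2
    refine h2.trans ?_
    have h3 := hall j (by omega)
    have h4 : 1 / (4 * H) + 1 / (4 * H) ≤ 1 / 2 := by
      rw [← hr]; exact le_mul_of_one_le_left (by positivity) hH0
    gcongr
    exact h3.trans h4
  have h2 := hU' j ((U ^ j) (u - u'))
  rw [hU, U_inv_pow_pow, ← hU] at h2
  refine h2.trans ?_
  calc C₁ * Real.exp ((-Lu + ε) * j) * ‖(U ^ j) (u - u')‖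
      ≤ C₁ * Real.exp ((-Lu + ε) * j) * (K * (1 / 2)) := by gcongr
    _ = C₁ * (K * (1 / 2)) * Real.exp ((-Lu + ε) * j) := by ring
    _ = C₁ * (K * (1 / 2)) * (Real.exp (Lu - ε) * Real.exp (-((Lu - ε) * (j + 1 : ℕ)))) := by
      rw [← Real.exp_add]; push_cast; ring_nf
    _ = _ := by ring

/-- A Bowen ball of length n meets the unstable leaf s = 0 in diameter about exp(-(Lu-ε)n); the
Hölder inverse turns this into Lebesgue measure at most a constant times exp(-(Lu-ε)θkn). The stable
directions contribute no entropy, so one point per leaf is enough. -/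
theorem le_bowenEntropy_of_holder_inverse {θ ε : ℝ} (hθ : 0 < θ) (hε : 0 < ε) (hεL : ε < Lu)
    {x : (Fin k → ℝ) → (Fin k → ℝ)} (hx1 : ∀ y, ‖x y‖ ≤ 1)
    (hx : ∀ y ∈ unitCube k, ∀ y' ∈ unitCube k, ‖y - y'‖ ≤ 16 * ‖x y - x y'‖ ^ θ)
    {E : Set (Torus d)} (hE : ∀ y, σ.point 0 (x y) ∈ E) :
    ENNReal.ofReal ((Lu - ε) * θ * k) ≤ bowenEntropy (toralMap A) E := by
  obtain ⟨r, C, hr, hC, hball⟩ := σ.exists_norm_le_of_bowenBall hε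
  have hL : 0 < Lu - ε := by linarith
  refine le_trans ?_ (le_iSup₂ r hr)
  set D : ℝ := (32 * C ^ θ) ^ k with hD
  have hD0 : 0 ≤ D := by positivity
  refine le_bowenEntropyAt_of_measure_preimage_le (toralMap A) volume (S := unitCube k)
    (F := fun y => σ.point 0 (x y)) (s := ((Lu - ε) * θ * k).toNNReal) (C := D.toNNReal)
    (by simp [volume_unitCube]) (fun y _ => hE y) ?_
  intro n p hn
  rw [Real.coe_toNNReal _ (by positivity)]
  rcases (unitCube k ∩ (fun y => σ.point 0 (x y)) ⁻¹' bowenBall (toralMap A) n p r).eq_empty_or_nonempty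
    with h0 | ⟨y₀, hy₀, hb₀⟩
  · rw [h0]; simp
  have hsub : unitCube k ∩ (fun y => σ.point 0 (x y)) ⁻¹' bowenBall (toralMap A) n p r ⊆
      closedBall y₀ (16 * (C * Real.exp (-((Lu - ε) * n))) ^ θ) := by
    rintro y ⟨hy, hb⟩
    rw [mem_closedBall, dist_eq_norm]
    refine (hx y hy y₀ hy₀).trans ?_
    have := hball n p _ _ hn (hx1 y) (hx1 y₀) hb hb₀
    gcongr
  refine (measure_mono hsub).trans ?_
  rw [Real.volume_pi_closedBall _ (by positivity), Fintype.card_fin]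
  change _ ≤ ENNReal.ofReal D * _
  rw [← ENNReal.ofReal_mul hD0]
  apply ENNReal.ofReal_le_ofReal
  apply le_of_eq
  rw [Real.mul_rpow hC.le (Real.exp_pos _).le, ← Real.exp_mul]
  have e1 : Real.exp (-((Lu - ε) * θ * k * n)) = Real.exp (-((Lu - ε) * n) * θ) ^ k := by
    rw [← Real.exp_nat_mul]; ring_nf
  rw [e1, hD]
  ring

end Splitting

end

/-! ### Covers and the upper bounds. -/

section

open Filter Topology MeasureTheory Metric

section Covers

variable {X ι : Type*} [MetricSpace X]

theorem tsum_ofReal_exp_neg_ne_top {γ : ℝ} (hγ : 0 < γ) (C : ℝ) :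
    ∑' n : ℕ, ENNReal.ofReal (C * Real.exp (-(γ * n))) ≠ ⊤ := by
  apply Summable.tsum_ofReal_ne_top
  apply Summable.mul_left
  have : ∀ n : ℕ, Real.exp (-(γ * n)) = Real.exp (n * (-γ)) := fun n => by ring_nf
  simp_rw [this]
  exact Real.summable_exp_nat_mul_iff.2 (by linarith)

/-- Upper bound for the Hausdorff dimension of a limsup set. -/
theorem dimH_le_of_limsup_cover {E : Set X} {J : ℕ → Finset ι} {P : ℕ → ι → Set X}
    (hcov : ∀ N, E ⊆ ⋃ n ≥ N, ⋃ q ∈ J n, P n q) {β κ C D : ℝ} (hD : 0 ≤ D)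
    (hcard : ∀ n, ((J n).card : ℝ) ≤ C * Real.exp (β * n))
    (hdiam : ∀ n, ∀ q, ediam (P n q) ≤ ENNReal.ofReal (D * Real.exp (-(κ * n)))) (hκ : 0 < κ)
    {s : ℝ≥0} (hs : β < s * κ) : dimH E ≤ s := by
  borelize X
  apply dimH_le_of_hausdorffMeasure_ne_top
  have hC : 0 ≤ C := by
    have := (Nat.cast_nonneg _).trans (hcard 0)
    simpa using this
  set B : ℝ≥0∞ := ∑' n : ℕ, ENNReal.ofReal (C * D ^ (s : ℝ) * Real.exp (-((s * κ - β) * n))) with hB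
  have hBtop : B ≠ ⊤ := tsum_ofReal_exp_neg_ne_top (by linarith) _
  refine ne_top_of_le_ne_top hBtop ?_
  have hr : Tendsto (fun N : ℕ => ENNReal.ofReal (D * Real.exp (-(κ * N)))) atTop (𝓝 0) := by
    rw [← ENNReal.ofReal_zero]
    apply ENNReal.tendsto_ofReal
    rw [← mul_zero D]
    apply Tendsto.const_mul
    exact Real.tendsto_exp_neg_atTop_nhds_zero.comp
      (tendsto_natCast_atTop_atTop.const_mul_atTop hκ)
  -- The index is shifted by N so that all tails are bounded termwise by the single convergent
  -- series `B`; a finite Hausdorff measure suffices.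
  refine (Measure.hausdorffMeasure_le_liminf_tsum (ι := fun N : ℕ => Σ n : ℕ, J (n + N)) (s : ℝ) E
    _ hr (fun N p => P (p.1 + N) p.2) (Eventually.of_forall ?_) (Eventually.of_forall ?_)).trans ?_
  · rintro N ⟨n, q⟩
    refine (hdiam _ _).trans (ENNReal.ofReal_le_ofReal ?_)
    gcongr
    simp
  · intro N x hx
    obtain ⟨n, hn, q, hq, hxq⟩ : ∃ n, N ≤ n ∧ ∃ q ∈ J n, x ∈ P n q := by
      simpa using hcov N hx
    obtain ⟨j, rfl⟩ := Nat.exists_eq_add_of_le' hn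
    exact Set.mem_iUnion.2 ⟨⟨j, ⟨q, hq⟩⟩, hxq⟩
  · refine liminf_le_of_frequently_le' (Frequently.of_forall fun N => ?_)
    rw [ENNReal.tsum_sigma']
    refine ENNReal.tsum_le_tsum fun n => ?_
    have hterm : ∀ q : J (n + N), ediam (P (n + N) q) ^ (s : ℝ) ≤
        ENNReal.ofReal (D ^ (s : ℝ) * Real.exp (-(s * κ * (n + N : ℕ)))) := by
      intro q
      refine (ENNReal.rpow_le_rpow (hdiam _ _) (NNReal.coe_nonneg s)).trans (le_of_eq ?_)
      rw [ENNReal.ofReal_rpow_of_nonneg (by positivity) (NNReal.coe_nonneg s),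
        Real.mul_rpow hD (Real.exp_pos _).le, ← Real.exp_mul]
      ring_nf
    refine (ENNReal.tsum_le_tsum hterm).trans ?_
    rw [tsum_fintype, Finset.sum_const, Finset.card_univ, Fintype.card_coe, nsmul_eq_mul,
      ← ENNReal.ofReal_natCast, ← ENNReal.ofReal_mul (Nat.cast_nonneg _)]
    apply ENNReal.ofReal_le_ofReal
    calc ((J (n + N)).card : ℝ) * (D ^ (s : ℝ) * Real.exp (-(s * κ * (n + N : ℕ))))
        ≤ C * Real.exp (β * (n + N : ℕ)) * (D ^ (s : ℝ) * Real.exp (-(s * κ * (n + N : ℕ)))) := by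
          gcongr
          exact hcard _
      _ = C * D ^ (s : ℝ) * (Real.exp (β * (n + N : ℕ)) * Real.exp (-(s * κ * (n + N : ℕ)))) := by
          ring
      _ = C * D ^ (s : ℝ) * Real.exp (-((s * κ - β) * (n + N : ℕ))) := by
          rw [← Real.exp_add]; ring_nf
      _ ≤ C * D ^ (s : ℝ) * Real.exp (-((s * κ - β) * n)) := by
          have : 0 < s * κ - β := by linarith
          gcongr
          simp

/-- Upper bound for the Bowen entropy of a limsup set. -/
theorem bowenEntropyAt_le_of_limsup_cover [Nonempty X] (f : X → X) {ρ : ℝ} {E : Set X}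
    {J : ℕ → Finset ι} {P : ℕ → ι → Set X}
    (hcov : ∀ N, E ⊆ ⋃ n ≥ N, ⋃ q ∈ J n, P n q) {β ℓ C : ℝ}
    (hcard : ∀ n, ((J n).card : ℝ) ≤ C * Real.exp (β * n)) (hℓ : 0 < ℓ)
    (hball : ∀ᶠ n in atTop, ∀ q, ∀ x ∈ P n q, P n q ⊆ bowenBall f ⌈ℓ * n⌉₊ x ρ)
    {s : ℝ≥0} (hs : β < s * ℓ) : bowenEntropyAt f ρ E ≤ s := by
  classical
  refine iInf₂_le s ?_
  have hC : 0 ≤ C := by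
    have := (Nat.cast_nonneg _).trans (hcard 0)
    simpa using this
  set γ : ℝ := s * ℓ - β with hγ
  have hγ0 : 0 < γ := by linarith
  set B : ℝ≥0∞ := ∑' n : ℕ, ENNReal.ofReal (C * Real.exp (-(γ * n))) with hB
  have hBtop : B ≠ ⊤ := tsum_ofReal_exp_neg_ne_top hγ0 _
  refine ENNReal.iSup_eq_zero.2 fun N => ?_
  have hlim : Tendsto (fun n : ℕ => ENNReal.ofReal (Real.exp (-(γ * n))) * B) atTop (𝓝 0) := by
    rw [← zero_mul B]
    refine ENNReal.Tendsto.mul_const ?_ (Or.inr hBtop)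
    rw [← ENNReal.ofReal_zero]
    apply ENNReal.tendsto_ofReal
    exact Real.tendsto_exp_neg_atTop_nhds_zero.comp
      (tendsto_natCast_atTop_atTop.const_mul_atTop hγ0)
  refine le_antisymm (ge_of_tendsto hlim ?_) bot_le
  have hN : ∀ᶠ n : ℕ in atTop, (N : ℝ) ≤ ℓ * n :=
    (tendsto_natCast_atTop_atTop.const_mul_atTop hℓ).eventually_ge_atTop _
  filter_upwards [hN, eventually_forall_ge_atTop.2 hball] with N' hN' hball'
  -- An arbitrary centre inside each piece. For an empty piece the value is junk, which only adds a
  -- superfluous ball to the family.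
  let pt : ℕ → ι → X := fun n q => Classical.epsilon fun x => x ∈ P n q
  let I : ℕ → Finset (X × ℕ) := fun n =>
    (J (n + N')).image fun q => (pt (n + N') q, ⌈ℓ * (n + N' : ℕ)⌉₊)
  have hI2 : ∀ n, ∀ p ∈ I n, p.2 = ⌈ℓ * (n + N' : ℕ)⌉₊ := by
    intro n p hp
    obtain ⟨q, _, rfl⟩ := Finset.mem_image.1 hp
    rfl
  refine iInf_le_of_le (⋃ n, (I n : Set (X × ℕ))) (iInf_le_of_le
    (Set.countable_iUnion fun n => (I n).countable_toSet) (iInf_le_of_le ?_ (iInf_le_of_le ?_ ?_)))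
  · intro p hp
    obtain ⟨n, hn⟩ := Set.mem_iUnion.1 hp
    rw [hI2 n p hn]
    have : (N : ℝ) ≤ ⌈ℓ * (n + N' : ℕ)⌉₊ := by
      refine hN'.trans (le_trans ?_ (Nat.le_ceil _))
      gcongr
      simp
    exact_mod_cast this
  · intro x hx
    obtain ⟨n, hn, q, hq, hxq⟩ : ∃ n, N' ≤ n ∧ ∃ q ∈ J n, x ∈ P n q := by
      simpa using hcov N' hx
    obtain ⟨j, rfl⟩ := Nat.exists_eq_add_of_le' hn
    refine Set.mem_iUnion₂.2 ⟨(pt (j + N') q, ⌈ℓ * (j + N' : ℕ)⌉₊), ?_, ?_⟩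
    · exact Set.mem_iUnion.2 ⟨j, Finset.mem_image.2 ⟨q, hq, rfl⟩⟩
    · exact hball' (j + N') hn q (pt (j + N') q)
        (Classical.epsilon_spec (p := fun x => x ∈ P (j + N') q) ⟨x, hxq⟩) hxq
  · refine (ENNReal.tsum_iUnion_le_tsum
      (fun p : X × ℕ => ENNReal.ofReal (Real.exp (-(s * p.2)))) _).trans ?_
    rw [hB, ← ENNReal.tsum_mul_left]
    refine ENNReal.tsum_le_tsum fun n => ?_
    rw [Finset.tsum_subtype' (I n) (fun p : X × ℕ => ENNReal.ofReal (Real.exp (-(s * p.2))))]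
    have hterm : ∀ p ∈ I n, ENNReal.ofReal (Real.exp (-(s * p.2))) ≤
        ENNReal.ofReal (Real.exp (-(s * ℓ * (n + N' : ℕ)))) := by
      intro p hp
      rw [hI2 n p hp]
      apply ENNReal.ofReal_le_ofReal
      rw [mul_assoc]
      have := Nat.le_ceil (ℓ * (n + N' : ℕ))
      gcongr
    refine (Finset.sum_le_sum hterm).trans ?_
    rw [Finset.sum_const, nsmul_eq_mul, ← ENNReal.ofReal_natCast,
      ← ENNReal.ofReal_mul (Nat.cast_nonneg _), ← ENNReal.ofReal_mul (Real.exp_pos _).le]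
    apply ENNReal.ofReal_le_ofReal
    have hcI : ((I n).card : ℝ) ≤ C * Real.exp (β * (n + N' : ℕ)) :=
      le_trans (by exact_mod_cast Finset.card_image_le) (hcard (n + N'))
    calc ((I n).card : ℝ) * Real.exp (-(s * ℓ * (n + N' : ℕ)))
        ≤ C * Real.exp (β * (n + N' : ℕ)) * Real.exp (-(s * ℓ * (n + N' : ℕ))) := by gcongr
      _ = Real.exp (-(γ * N')) * (C * Real.exp (-(γ * n))) := by
        rw [mul_assoc, ← Real.exp_add, mul_left_comm, ← Real.exp_add, hγ]
        push_cast
        ring_nf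

end Covers

/-- The cells of a grid of mesh `δ` that meet a ball of radius `R`. -/
theorem exists_finset_floor_mem {m : ℕ} {R δ : ℝ} (hR : 0 ≤ R) (hδ : 0 < δ) :
    ∃ J : Finset (Fin m → ℤ), (J.card : ℝ) ≤ (2 * (R / δ) + 3) ^ m ∧
      ∀ s : Fin m → ℝ, ‖s‖ ≤ R → (fun l => ⌊s l / δ⌋) ∈ J := by
  set r : ℤ := ⌈R / δ⌉ with hr
  have hr0 : 0 ≤ r := Int.ceil_nonneg (by positivity)
  refine ⟨Fintype.piFinset fun _ => Finset.Icc (-r) r, ?_, fun s hs => ?_⟩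
  · rw [Fintype.card_piFinset_const, Int.card_Icc]
    push_cast
    gcongr
    have h1 : (((r + 1 - -r).toNat : ℤ) : ℝ) = 2 * r + 1 := by
      rw [Int.toNat_of_nonneg (by omega)]; push_cast; ring
    have h2 : (r : ℝ) < R / δ + 1 := Int.ceil_lt_add_one _
    have h3 : (((r + 1 - -r).toNat : ℕ) : ℝ) = 2 * r + 1 := by exact_mod_cast h1
    rw [h3]
    linarith
  · rw [Fintype.mem_piFinset]
    intro l
    have h1 : |s l| ≤ R := (norm_le_pi_norm s l).trans hs
    have h2 : |s l / δ| ≤ R / δ := by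
      rw [abs_div, abs_of_pos hδ]; gcongr
    have h3 := Int.le_ceil (R / δ)
    rw [abs_le] at h2
    rw [Finset.mem_Icc]
    constructor
    · rw [Int.le_floor]; push_cast; linarith
    · have : (⌊s l / δ⌋ : ℝ) ≤ r := (Int.floor_le _).trans (h2.2.trans h3)
      exact_mod_cast this

theorem norm_sub_le_of_floor_eq {m : ℕ} {δ : ℝ} (hδ : 0 < δ) {s s' : Fin m → ℝ}
    (h : (fun l => ⌊s l / δ⌋) = fun l => ⌊s' l / δ⌋) : ‖s - s'‖ ≤ δ := by
  rw [pi_norm_le_iff_of_nonneg hδ.le]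
  intro l
  have := Int.abs_sub_lt_one_of_floor_eq_floor (congrFun h l)
  rw [← sub_div, abs_div, abs_of_pos hδ, div_lt_one hδ] at this
  exact this.le

namespace Splitting

variable {d m k : ℕ} {A : Matrix (Fin d) (Fin d) ℤ} {Ls Lu : ℝ} (σ : Splitting A Ls Lu m k)

/-- The preimage of a ball of radius `r` under `f ^ n` is covered by the preimages of sets which
are of size `δ` in the stable and `r` in the unstable direction. -/
theorem exists_cover_preimage_ball (hinj : Function.Injective (toralMap A)) :
    ∃ K : ℝ, 0 < K ∧ ∀ (n : ℕ) (z : Torus d) (r δ : ℝ), 0 < r → 0 < δ →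
      ∃ (J : Finset (Fin m → ℤ)) (P : (Fin m → ℤ) → Set (Torus d)),
        (J.card : ℝ) ≤ (2 * (K * r / δ) + 3) ^ m ∧
        {x | dist ((toralMap A)^[n] x) z < r} ⊆ ⋃ q ∈ J, P q ∧
        ∀ q, ∀ x ∈ P q, ∀ x' ∈ P q, ∃ s s' u u', ‖s - s'‖ ≤ δ ∧ ‖u - u'‖ ≤ 2 * (K * r) ∧
          x = σ.point ((((σ.S⁻¹ : _ˣ) : (Fin m → ℝ) →L[ℝ] (Fin m → ℝ)) ^ n) s)
            ((((σ.U⁻¹ : _ˣ) : (Fin k → ℝ) →L[ℝ] (Fin k → ℝ)) ^ n) u) ∧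
          x' = σ.point ((((σ.S⁻¹ : _ˣ) : (Fin m → ℝ) →L[ℝ] (Fin m → ℝ)) ^ n) s')
            ((((σ.U⁻¹ : _ˣ) : (Fin k → ℝ) →L[ℝ] (Fin k → ℝ)) ^ n) u') := by
  obtain ⟨K, hK0, hK⟩ := σ.exists_norm_le_norm_e
  refine ⟨K, hK0, fun n z r δ hr hδ => ?_⟩
  obtain ⟨zl, rfl⟩ := torusProj_surjective z
  set w := σ.e.symm zl with hw
  obtain ⟨J, hJ, hJmem⟩ := exists_finset_floor_mem (m := m) (R := K * r) (by positivity) hδ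
  refine ⟨J, fun q => {x | ∃ s u, (fun l => ⌊(s - w.1) l / δ⌋) = q ∧ ‖u - w.2‖ ≤ K * r ∧
    x = σ.point ((((σ.S⁻¹ : _ˣ) : (Fin m → ℝ) →L[ℝ] (Fin m → ℝ)) ^ n) s)
            ((((σ.U⁻¹ : _ˣ) : (Fin k → ℝ) →L[ℝ] (Fin k → ℝ)) ^ n) u)}, hJ, ?_, ?_⟩
  · intro x hx
    rw [Set.mem_ofPred_eq, dist_comm] at hx
    obtain ⟨v, hv, hvz⟩ := exists_lift_near zl ((toralMap A)^[n] x)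
    set y := σ.e.symm v with hy
    have hyv : σ.e (y.1, y.2) = v := by simp [hy]
    have hyw : ‖y - w‖ ≤ K * r := by
      refine (hK _).trans ?_
      rw [map_sub, hy, hw, ContinuousLinearEquiv.apply_symm_apply,
        ContinuousLinearEquiv.apply_symm_apply, norm_sub_rev]
      gcongr
      exact hvz.trans hx.le
    refine Set.mem_iUnion₂.2 ⟨_, hJmem (y.1 - w.1) ((norm_fst_le (y - w)).trans hyw),
      y.1, y.2, rfl, (norm_snd_le (y - w)).trans hyw, ?_⟩
    -- Injectivity of f^n makes the preimage of the ball a single pulled-back box, with no other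
    -- branches.
    apply hinj.iterate n
    rw [iterate_point, S_pow_inv_pow, U_pow_inv_pow, point, hyv, hv]
  · rintro q x ⟨s, u, hq, hu, rfl⟩ x' ⟨s', u', hq', hu', rfl⟩
    refine ⟨s, s', u, u', ?_, ?_, rfl, rfl⟩
    · have := norm_sub_le_of_floor_eq hδ (hq.trans hq'.symm)
      simpa using this
    · have : u - u' = (u - w.2) - (u' - w.2) := by abel
      rw [this]
      exact (norm_sub_le _ _).trans (by linarith)

/-- Covers of the preimages of exponentially small balls, with stable mesh `exp (-a * n)`. -/
theorem exists_cover_preimage_exp_ball (hinj : Function.Injective (toralMap A)) {a t : ℝ}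
    (hat : t ≤ a) (z : ℕ → Torus d) :
    ∃ K : ℝ, 0 < K ∧ ∃ (J : ℕ → Finset (Fin m → ℤ)) (P : ℕ → (Fin m → ℤ) → Set (Torus d)),
      (∀ n : ℕ, ((J n).card : ℝ) ≤ (2 * K + 3) ^ m * Real.exp ((a - t) * m * n)) ∧
      (∀ n : ℕ, {x | dist ((toralMap A)^[n] x) (z n) < Real.exp (-(t * n))} ⊆
        ⋃ q ∈ J n, P n q) ∧
      ∀ n : ℕ, ∀ q, ∀ x ∈ P n q, ∀ x' ∈ P n q, ∃ s s' u u',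
        ‖s - s'‖ ≤ Real.exp (-(a * n)) ∧ ‖u - u'‖ ≤ 2 * (K * Real.exp (-(t * n))) ∧
          x = σ.point ((((σ.S⁻¹ : _ˣ) : (Fin m → ℝ) →L[ℝ] (Fin m → ℝ)) ^ n) s)
            ((((σ.U⁻¹ : _ˣ) : (Fin k → ℝ) →L[ℝ] (Fin k → ℝ)) ^ n) u) ∧
          x' = σ.point ((((σ.S⁻¹ : _ˣ) : (Fin m → ℝ) →L[ℝ] (Fin m → ℝ)) ^ n) s')
            ((((σ.U⁻¹ : _ˣ) : (Fin k → ℝ) →L[ℝ] (Fin k → ℝ)) ^ n) u') := by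
  obtain ⟨K, hK0, h⟩ := σ.exists_cover_preimage_ball hinj
  choose J P hJ hcov hP using fun n : ℕ => h n (z n) (Real.exp (-(t * n))) (Real.exp (-(a * n)))
    (Real.exp_pos _) (Real.exp_pos _)
  refine ⟨K, hK0, J, P, fun n => (hJ n).trans ?_, hcov, hP⟩
  have h1 : K * Real.exp (-(t * n)) / Real.exp (-(a * n)) = K * Real.exp ((a - t) * n) := by
    rw [mul_div_assoc, ← Real.exp_sub]; ring_nf
  -- This is where t ≤ a enters: the additive 3 in the count is absorbed into the exponential.
  have h2 : 1 ≤ Real.exp ((a - t) * n) :=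
    Real.one_le_exp (mul_nonneg (by linarith) (Nat.cast_nonneg _))
  have h3 : Real.exp ((a - t) * m * n) = Real.exp ((a - t) * n) ^ m := by
    rw [← Real.exp_nat_mul]; ring_nf
  rw [h1, h3, ← mul_pow]
  gcongr
  nlinarith

/-- After pull-back the pieces have stable size about exp((Ls-a)n) and unstable size about
exp(-(Lu+t)n), hence diameter of order at most exp(-κn), and there are about exp((a-t)mn) of them.
-/
theorem dimH_le_of_hits (σ : Splitting A Ls Lu m k) (hinj : Function.Injective (toralMap A)) {a t κ : ℝ} (hat : t ≤ a)
    (hκ : 0 < κ) (hκs : κ < a - Ls) (hκu : κ < Lu + t) {z : ℕ → Torus d} {E : Set (Torus d)}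
    (hE : ∀ x ∈ E, ∀ N, ∃ n ≥ N, dist ((toralMap A)^[n] x) (z n) < Real.exp (-(t * n)))
    {s : ℝ≥0} (hs : (a - t) * m < s * κ) : dimH E ≤ s := by
  obtain ⟨K, hK0, J, P, hJ, hcov, hP⟩ := σ.exists_cover_preimage_exp_ball hinj hat z
  -- The whole gap is spent as growth slack, here and for the unstable part, so that both sizes
  -- decay at exactly the rate κ.
  obtain ⟨C₁, hC₁, hS⟩ := σ.growth_S_inv.exists_norm_apply_le
    (show 0 < a - Ls - κ by linarith)
  obtain ⟨C₂, hC₂, hU⟩ := σ.growth_U_inv.exists_norm_apply_le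
    (show 0 < Lu + t - κ by linarith)
  refine dimH_le_of_limsup_cover (J := J) (P := P) ?_ (C := (2 * K + 3) ^ m)
    (D := d * (C₁ + C₂ * (2 * K))) (by positivity) hJ ?_ hκ hs
  · intro N x hx
    obtain ⟨n, hn, hd⟩ := hE x hx N
    exact Set.mem_iUnion₂.2 ⟨n, hn, hcov n hd⟩
  · intro n q
    refine ediam_le fun x hx x' hx' => ?_
    obtain ⟨s, s', u, u', hs, hu, rfl, rfl⟩ := hP n q x hx x' hx'
    rw [edist_dist]
    apply ENNReal.ofReal_le_ofReal
    refine (σ.dist_point_le _ _ _ _).trans ?_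
    rw [mul_assoc]
    gcongr
    rw [← map_sub, ← map_sub]
    have b1 := hS n (s - s')
    have b2 := hU n (u - u')
    have e1 : C₁ * Real.exp ((Ls + (a - Ls - κ)) * n) * ‖s - s'‖ ≤ C₁ * Real.exp (-(κ * n)) := by
      calc _ ≤ C₁ * Real.exp ((Ls + (a - Ls - κ)) * n) * Real.exp (-(a * n)) := by gcongr
        _ = _ := by rw [mul_assoc, ← Real.exp_add]; ring_nf
    have e2 : C₂ * Real.exp ((-Lu + (Lu + t - κ)) * n) * ‖u - u'‖ ≤
        C₂ * (2 * K) * Real.exp (-(κ * n)) := by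
      calc _ ≤ C₂ * Real.exp ((-Lu + (Lu + t - κ)) * n) * (2 * (K * Real.exp (-(t * n)))) := by
            gcongr
        _ = C₂ * (2 * K) * (Real.exp ((-Lu + (Lu + t - κ)) * n) * Real.exp (-(t * n))) := by ring
        _ = _ := by rw [← Real.exp_add]; ring_nf
    have p1 : 0 ≤ C₁ * Real.exp (-(κ * n)) := by positivity
    have p2 : 0 ≤ C₂ * (2 * K) * Real.exp (-(κ * n)) := by positivity
    rw [add_mul]
    exact max_le (by linarith) (by linarith)

/-- As a > Ls, the stable size is small at time 0 and remains so under the stable dynamics; the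
unstable size exp(-(Lu+t)n) stays small up to time ℓn because Lu·ℓ < Lu + t. So each piece lies in a
Bowen ball of length about ℓn. -/
theorem bowenEntropy_le_of_hits (σ : Splitting A Ls Lu m k)
    (hinj : Function.Injective (toralMap A)) (hLs : 0 < Ls) (hLu : 0 < Lu)
    {a t ℓ : ℝ} (hat : t ≤ a) (haLs : Ls < a) (hℓ : 0 < ℓ)
    (hℓu : Lu * ℓ < Lu + t) {z : ℕ → Torus d} {E : Set (Torus d)}
    (hE : ∀ x ∈ E, ∀ N, ∃ n ≥ N, dist ((toralMap A)^[n] x) (z n) < Real.exp (-(t * n)))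
    {s : ℝ≥0} (hs : (a - t) * m < s * ℓ) : bowenEntropy (toralMap A) E ≤ s := by
  refine iSup₂_le fun ρ hρ => ?_
  obtain ⟨K, hK0, J, P, hJ, hcov, hP⟩ := σ.exists_cover_preimage_exp_ball hinj hat z
  obtain ⟨ε, hε, hεL, hεa, hεu⟩ : ∃ ε : ℝ, 0 < ε ∧ ε < Ls ∧ Ls + ε < a ∧
      (Lu + ε) * ℓ + (-Lu + ε) - t < 0 := by
    have h1 : ∀ᶠ ε in 𝓝[>] (0 : ℝ), ε < Ls :=
      nhdsWithin_le_nhds (eventually_lt_nhds hLs)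
    have h2 : ∀ᶠ ε in 𝓝[>] (0 : ℝ), ε < a - Ls :=
      nhdsWithin_le_nhds (eventually_lt_nhds (by linarith))
    have h3 : ∀ᶠ ε in 𝓝[>] (0 : ℝ), (Lu + ε) * ℓ + (-Lu + ε) - t < 0 := by
      have hcont : ContinuousAt (fun ε : ℝ => (Lu + ε) * ℓ + (-Lu + ε) - t) 0 := by fun_prop
      refine nhdsWithin_le_nhds (hcont.eventually_lt_const ?_)
      simp only [add_zero]
      linarith
    obtain ⟨ε, h₀, h₁, h₂, h₃⟩ := (eventually_mem_nhdsWithin.and (h1.and (h2.and h3))).exists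
    exact ⟨ε, h₀, h₁, by linarith [h₂], h₃⟩
  obtain ⟨C₁, hC₁, hS'⟩ := σ.growth_S_inv.exists_norm_apply_le hε
  obtain ⟨C₂, hC₂, hU'⟩ := σ.growth_U_inv.exists_norm_apply_le hε
  obtain ⟨C₃, hC₃, hS⟩ := σ.growth_S.exists_norm_apply_le hε
  obtain ⟨C₄, hC₄, hU⟩ := σ.growth_U.exists_norm_apply_le hε
  refine bowenEntropyAt_le_of_limsup_cover (toralMap A) (J := J) (P := P) ?_
    (C := (2 * K + 3) ^ m) hJ hℓ ?_ hs
  · intro N x hx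
    obtain ⟨n, hn, hd⟩ := hE x hx N
    exact Set.mem_iUnion₂.2 ⟨n, hn, hcov n hd⟩
  · filter_upwards [eventually_mul_exp_lt (show Ls + ε - a < 0 by linarith) (d * (C₃ * C₁) / ρ),
      eventually_mul_exp_lt hεu (d * (C₄ * C₂ * (2 * K)) / ρ)] with n h1 h2 q x hx x' hx' i hi
    have hi' : (i : ℝ) ≤ ℓ * n := (Nat.lt_ceil.1 hi).le
    obtain ⟨s, s', u, u', hs, hu, rfl, rfl⟩ := hP n q x hx x' hx'
    rw [iterate_point, iterate_point]
    refine (σ.dist_point_le _ _ _ _).trans_lt ?_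
    rw [zero_mul, Real.exp_zero, div_mul_eq_mul_div, div_lt_one hρ] at h1 h2
    rw [← map_sub, ← map_sub, ← map_sub, ← map_sub]
    set w := (((σ.S⁻¹ : _ˣ) : (Fin m → ℝ) →L[ℝ] (Fin m → ℝ)) ^ n) (s - s') with hw
    set v := (((σ.U⁻¹ : _ˣ) : (Fin k → ℝ) →L[ℝ] (Fin k → ℝ)) ^ n) (u - u') with hv
    have hi0 : (0 : ℝ) ≤ i := Nat.cast_nonneg _
    have e1 : ‖((σ.S : (Fin m → ℝ) →L[ℝ] (Fin m → ℝ)) ^ i) w‖ ≤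
        C₃ * C₁ * Real.exp ((Ls + ε - a) * n) := by
      refine (hS i w).trans ?_
      have g1 : Real.exp ((-Ls + ε) * i) ≤ 1 := Real.exp_le_one_iff.2 (by nlinarith)
      have g2 : ‖w‖ ≤ C₁ * Real.exp ((Ls + ε - a) * n) := by
        refine (hS' n _).trans ?_
        calc _ ≤ C₁ * Real.exp ((Ls + ε) * n) * Real.exp (-(a * n)) := by gcongr
          _ = _ := by rw [mul_assoc, ← Real.exp_add]; ring_nf
      calc _ ≤ C₃ * 1 * (C₁ * Real.exp ((Ls + ε - a) * n)) := by gcongr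
        _ = _ := by ring
    have e2 : ‖((σ.U : (Fin k → ℝ) →L[ℝ] (Fin k → ℝ)) ^ i) v‖ ≤
        C₄ * C₂ * (2 * K) * Real.exp (((Lu + ε) * ℓ + (-Lu + ε) - t) * n) := by
      refine (hU i v).trans ?_
      have g2 : ‖v‖ ≤ C₂ * (2 * K) * Real.exp ((-Lu + ε - t) * n) := by
        refine (hU' n _).trans ?_
        calc _ ≤ C₂ * Real.exp ((-Lu + ε) * n) * (2 * (K * Real.exp (-(t * n)))) := by gcongr
          _ = C₂ * (2 * K) * (Real.exp ((-Lu + ε) * n) * Real.exp (-(t * n))) := by ring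
          _ = _ := by rw [← Real.exp_add]; ring_nf
      calc _ ≤ C₄ * Real.exp ((Lu + ε) * (ℓ * n)) *
            (C₂ * (2 * K) * Real.exp ((-Lu + ε - t) * n)) := by gcongr
        _ = C₄ * C₂ * (2 * K) *
            (Real.exp ((Lu + ε) * (ℓ * n)) * Real.exp ((-Lu + ε - t) * n)) := by ring
        _ = _ := by rw [← Real.exp_add]; ring_nf
    rw [mul_max_of_nonneg _ _ (Nat.cast_nonneg d)]
    refine max_lt (lt_of_le_of_lt ?_ h1) (lt_of_le_of_lt ?_ h2)
    · rw [mul_assoc]; gcongr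
    · rw [mul_assoc]; gcongr

end Splitting

end

/-! ### Rates of the targets and assembly of the bounds. -/

section

open Filter Topology

section Rates

theorem eventually_lt_exp_of_lt_lowerRate {φ : ℕ → ℝ} (hφ : ∀ n, 0 < φ n) {t : ℝ}
    (h : (t : EReal) < lowerRate φ) : ∀ᶠ n : ℕ in atTop, φ n < Real.exp (-(t * n)) := by
  filter_upwards [eventually_lt_of_lt_liminf h, eventually_gt_atTop 0] with n hn hn0
  have hn1 : (0 : ℝ) < n := by exact_mod_cast hn0
  rw [EReal.coe_lt_coe_iff, lt_div_iff₀ hn1] at hn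
  rw [← Real.log_lt_iff_lt_exp (hφ n)]
  linarith

theorem frequently_exp_lt_of_lowerRate_lt {φ : ℕ → ℝ} (hφ : ∀ n, 0 < φ n) {t : ℝ}
    (h : lowerRate φ < (t : EReal)) : ∃ᶠ n : ℕ in atTop, Real.exp (-(t * n)) < φ n := by
  refine ((frequently_lt_of_liminf_lt (h := h)).and_eventually (eventually_gt_atTop 0)).mono ?_
  rintro n ⟨hn, hn0⟩
  have hn1 : (0 : ℝ) < n := by exact_mod_cast hn0
  rw [EReal.coe_lt_coe_iff, div_lt_iff₀ hn1] at hn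
  rw [← Real.lt_log_iff_exp_lt (hφ n)]
  linarith

theorem supLowerRate_nonneg {φ : ℕ → ℕ → ℝ} (hφ : ∀ j n, φ j n ∈ Set.Ioc (0 : ℝ) 1) :
    0 ≤ supLowerRate φ := by
  refine le_trans ?_ (le_iSup (fun j => lowerRate (φ j)) 0)
  refine le_liminf_of_le (h := Eventually.of_forall fun n => ?_)
  rw [EReal.coe_nonneg]
  have := Real.log_nonpos (hφ 0 n).1.le (hφ 0 n).2
  exact div_nonneg (by linarith) (Nat.cast_nonneg _)

/-- The upper bounds see E only through one target whose lower rate exceeds t. -/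
theorem exists_hits_of_lt_supLowerRate {X : Type*} [MetricSpace X] {f : X → X} {φ : ℕ → ℕ → ℝ}
    (hφ : ∀ j n, 0 < φ j n) {z : ℕ → ℕ → X} {t : ℝ} (h : (t : EReal) < supLowerRate φ) :
    ∃ j, ∀ x ∈ ⋂ j, shrinkingTarget f (φ j) (z j) Set.univ, ∀ N, ∃ n ≥ N,
      dist (f^[n] x) (z j n) < Real.exp (-(t * n)) := by
  obtain ⟨j, hj⟩ := lt_iSup_iff.1 h
  refine ⟨j, fun x hx N => ?_⟩
  obtain ⟨N₀, hN₀⟩ := eventually_atTop.1 (eventually_lt_exp_of_lt_lowerRate (hφ j) hj)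
  obtain ⟨n, hn, hn'⟩ := (Set.mem_iInter.1 hx j : Set.Infinite _).exists_gt (max N N₀)
  have h1 := le_max_left N N₀
  have h2 := le_max_right N N₀
  exact ⟨n, by omega, hn.2.trans (hN₀ n (by omega))⟩

end Rates

theorem le_ofReal_of_forall_lt_coe {a : ℝ≥0∞} {b : ℝ} (hb : 0 ≤ b)
    (h : ∀ s : ℝ≥0, b < s → a ≤ s) : a ≤ ENNReal.ofReal b := by
  refine ENNReal.le_of_forall_pos_le_add fun ε hε _ => ?_
  have := h (b.toNNReal + ε) (by
    push_cast
    rw [Real.coe_toNNReal _ hb]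
    have : (0 : ℝ) < ε := hε
    linarith)
  exact_mod_cast this

namespace Splitting

variable {d m k : ℕ} {A : Matrix (Fin d) (Fin d) ℤ} {Ls Lu : ℝ}

/-- The target set contains stable leaves through a Cantor set. -/
theorem exists_cantor_in_targets (σ : Splitting A Ls Lu m k) (hLu : 0 < Lu)
    {φ : ℕ → ℕ → ℝ} (hφ : ∀ j n, 0 < φ j n) (z : ℕ → ℕ → Torus d) {t θ : ℝ} (ht : 0 < t)
    (htLs : t < Ls) (hτ : supLowerRate φ < (t : EReal)) (hθ0 : 0 < θ)
    (hθ : θ * (Lu + t) < Lu * (1 - t / Ls)) :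
    ∃ x : (Fin k → ℝ) → (Fin k → ℝ), (∀ y, ‖x y‖ ≤ 1) ∧
      (∀ y ∈ unitCube k, ∀ y' ∈ unitCube k, ‖y - y'‖ ≤ 16 * ‖x y - x y'‖ ^ θ) ∧
      ∀ s y, ‖s‖ ≤ 1 →
        σ.point s (x y) ∈ ⋂ j, shrinkingTarget (toralMap A) (φ j) (z j) Set.univ := by
  have htL : 0 < t / Ls := div_pos ht (ht.trans htLs)
  obtain ⟨a, ha1, ha2⟩ := exists_between hθ
  have ha0 : 0 < a := lt_trans (by positivity) ha1
  have haLu : a < Lu := by nlinarith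
  obtain ⟨b, hb1, hb2⟩ := exists_between ((lt_div_iff₀' hθ0).2 ha1)
  have hθb : θ * b < a := by rwa [lt_div_iff₀' hθ0] at hb2
  have hθ1 : θ ≤ 1 := by
    by_contra hlt
    push Not at hlt
    nlinarith
  have hits := σ.eventually_exists_ball_hits hLu ht htLs ha2 hb1
  -- Stage i serves the target given by the first component of `Nat.unpair i`, so every target is
  -- served at infinitely many distinct times.
  obtain ⟨n, x, hn, hx1, hxG, hx⟩ := exists_cantor_map ha0 (by linarith) hθ0 hθ1 hθb
    (fun i n => {u : Fin k → ℝ | ∀ s : Fin m → ℝ, ‖s‖ ≤ 1 →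
      dist ((toralMap A)^[n] (σ.point s u)) (z (Nat.unpair i).1 n) < φ (Nat.unpair i).1 n}) (by
    intro i
    have hrate : lowerRate (φ (Nat.unpair i).1) < (t : EReal) :=
      (le_iSup (fun j => lowerRate (φ j)) _).trans_lt hτ
    refine ((frequently_exp_lt_of_lowerRate_lt (hφ _) hrate).and_eventually hits).mono ?_
    rintro n ⟨h1, h2⟩ c
    obtain ⟨u, hu, hball⟩ := h2 (z (Nat.unpair i).1 n) c
    exact ⟨u, hu, fun u' hu' s hs => (hball u' hu' s hs).trans h1⟩)
  refine ⟨x, hx1, fun y hy y' hy' => hx y y' (mem_unitCube.1 hy) (mem_unitCube.1 hy'),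
    fun s y hs => Set.mem_iInter.2 fun j => ?_⟩
  have hsub : Set.range (fun l => n (Nat.pair j l)) ⊆
      {n | n ∈ Set.univ ∧ dist ((toralMap A)^[n] (σ.point s (x y))) (z j n) < φ j n} := by
    rintro _ ⟨l, rfl⟩
    have := hxG y (Nat.pair j l) s hs
    rw [Nat.unpair_pair] at this
    exact ⟨trivial, this⟩
  refine Set.Infinite.mono hsub (Set.infinite_range_of_injective fun l l' h => ?_)
  exact (Nat.pair_eq_pair.1 (hn.injective h)).2

variable {φ : ℕ → ℕ → ℝ} {z : ℕ → ℕ → Torus d} {τ : ℝ}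

/-- For every exponent below the critical one there is a rate at which the Cantor construction
works. -/
theorem exists_rate (hτLs : τ < Ls) {θ : ℝ} (hLuτ : 0 < Lu + τ)
    (hθ : θ < Lu * (1 - τ / Ls) / (Lu + τ)) :
    ∃ t, τ < t ∧ t < Ls ∧ θ * (Lu + t) < Lu * (1 - t / Ls) := by
  rw [lt_div_iff₀ hLuτ] at hθ
  have h1 : ∀ᶠ t in 𝓝[>] τ, θ * (Lu + t) < Lu * (1 - t / Ls) := by
    have c1 : ContinuousAt (fun t : ℝ => θ * (Lu + t)) τ := by fun_prop
    have c2 : ContinuousAt (fun t : ℝ => Lu * (1 - t / Ls)) τ := by fun_prop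
    exact nhdsWithin_le_nhds (c1.eventually_lt c2 hθ)
  have h2 : ∀ᶠ t in 𝓝[>] τ, t < Ls := nhdsWithin_le_nhds (eventually_lt_nhds hτLs)
  obtain ⟨t, h, h'⟩ := (eventually_mem_nhdsWithin.and (h2.and h1)).exists
  exact ⟨t, h, h'⟩

/-- The Cantor sets exist for every exponent below Θ, so the bounds at Θ follow by letting θ
increase to Θ and, for the entropy, the loss ε in the expansion rate decrease to 0. -/
theorem lower_bounds (σ : Splitting A Ls Lu m k) (hLs : 0 < Ls) (hLu : 0 < Lu) (hm : 0 < m)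
    (hφ : ∀ j n, 0 < φ j n) (hτ : supLowerRate φ = (τ : EReal)) (hτ0 : 0 ≤ τ) (hτLs : τ < Ls) :
    (⋂ j, shrinkingTarget (toralMap A) (φ j) (z j) Set.univ).Nonempty ∧
      ENNReal.ofReal (Lu * (Lu * (1 - τ / Ls) / (Lu + τ)) * k) ≤
        bowenEntropy (toralMap A) (⋂ j, shrinkingTarget (toralMap A) (φ j) (z j) Set.univ) ∧
      ENNReal.ofReal (m + Lu * (1 - τ / Ls) / (Lu + τ) * k) ≤
        dimH (⋂ j, shrinkingTarget (toralMap A) (φ j) (z j) Set.univ) := by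
  set E := ⋂ j, shrinkingTarget (toralMap A) (φ j) (z j) Set.univ with hE
  set Θ := Lu * (1 - τ / Ls) / (Lu + τ) with hΘ
  have hΘ0 : 0 < Θ := by
    have : τ / Ls < 1 := (div_lt_one hLs).2 hτLs
    have : 0 < 1 - τ / Ls := by linarith
    positivity
  have key : ∀ θ, 0 < θ → θ < Θ → ∃ x : (Fin k → ℝ) → (Fin k → ℝ), (∀ y, ‖x y‖ ≤ 1) ∧
      (∀ y ∈ unitCube k, ∀ y' ∈ unitCube k, ‖y - y'‖ ≤ 16 * ‖x y - x y'‖ ^ θ) ∧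
      ∀ s y, ‖s‖ ≤ 1 → σ.point s (x y) ∈ E := by
    intro θ h0 h1
    obtain ⟨t, ht1, ht2, ht3⟩ := exists_rate hτLs (by linarith) h1
    exact σ.exists_cantor_in_targets hLu hφ z (hτ0.trans_lt ht1) ht2
      (by rw [hτ]; exact_mod_cast ht1) h0 ht3
  have hev : ∀ᶠ θ in 𝓝[<] Θ, 0 < θ ∧ θ < Θ :=
    ((eventually_gt_nhds hΘ0).filter_mono nhdsWithin_le_nhds).and eventually_mem_nhdsWithin
  refine ⟨?_, ?_, ?_⟩
  · obtain ⟨x, -, -, hx⟩ := key (Θ / 2) (by positivity) (by linarith)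
    exact ⟨_, hx 0 0 (by simp)⟩
  · have h1 : ∀ ε, 0 < ε → ε < Lu → ENNReal.ofReal ((Lu - ε) * Θ * k) ≤
        bowenEntropy (toralMap A) E := by
      intro ε hε hεL
      have hlim : Tendsto (fun θ : ℝ => ENNReal.ofReal ((Lu - ε) * θ * k)) (𝓝[<] Θ)
          (𝓝 (ENNReal.ofReal ((Lu - ε) * Θ * k))) := by
        apply ENNReal.tendsto_ofReal
        apply tendsto_nhdsWithin_of_tendsto_nhds
        exact Continuous.tendsto (by fun_prop) Θ
      refine le_of_tendsto hlim ?_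
      filter_upwards [hev] with θ hθ
      obtain ⟨x, hx1, hx, hxE⟩ := key θ hθ.1 hθ.2
      exact σ.le_bowenEntropy_of_holder_inverse hθ.1 hε hεL hx1 hx
        (fun y => hxE 0 y (by simp))
    have hlim : Tendsto (fun ε : ℝ => ENNReal.ofReal ((Lu - ε) * Θ * k)) (𝓝[>] 0)
        (𝓝 (ENNReal.ofReal ((Lu - 0) * Θ * k))) := by
      apply ENNReal.tendsto_ofReal
      apply tendsto_nhdsWithin_of_tendsto_nhds
      exact Continuous.tendsto (f := fun ε : ℝ => (Lu - ε) * Θ * k) (by fun_prop) 0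
    rw [sub_zero] at hlim
    refine le_of_tendsto hlim ?_
    filter_upwards [eventually_mem_nhdsWithin,
      nhdsWithin_le_nhds (eventually_lt_nhds hLu)] with ε hε hεL
    exact h1 ε hε hεL
  · have hlim : Tendsto (fun θ : ℝ => ENNReal.ofReal (m + θ * k)) (𝓝[<] Θ)
        (𝓝 (ENNReal.ofReal (m + Θ * k))) := by
      apply ENNReal.tendsto_ofReal
      apply tendsto_nhdsWithin_of_tendsto_nhds
      exact Continuous.tendsto (by fun_prop) Θ
    refine le_of_tendsto hlim ?_
    filter_upwards [hev] with θ hθ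
    obtain ⟨x, hx1, hx, hxE⟩ := key θ hθ.1 hθ.2
    exact σ.le_dimH_of_holder_inverse hm hθ.1 hx1 hx hxE

theorem dimH_le (σ : Splitting A Ls Lu m k) (hinj : Function.Injective (toralMap A))
    (hLs : 0 < Ls) (hLu : 0 < Lu) (hφ : ∀ j n, 0 < φ j n)
    (hτ : (τ : EReal) ≤ supLowerRate φ) (hτ0 : 0 ≤ τ) :
    dimH (⋂ j, shrinkingTarget (toralMap A) (φ j) (z j) Set.univ) ≤
      ENNReal.ofReal (m * ((Ls + Lu) / (Lu + τ))) := by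
  refine le_ofReal_of_forall_lt_coe (by positivity) fun s hs => ?_
  have hs0 : (0 : ℝ) < s := lt_of_le_of_lt (by positivity) hs
  have hs' : (Ls + Lu) * m / s < Lu + τ := by
    rw [div_lt_iff₀ hs0]
    rw [← mul_div_assoc, div_lt_iff₀ (by linarith)] at hs
    linarith
  obtain ⟨κ, hκ1, hκ2⟩ := exists_between hs'
  have hκ0 : 0 < κ := lt_of_le_of_lt (by positivity) hκ1
  obtain ⟨t, ht1, ht2⟩ := exists_between (show κ - Lu < τ by linarith)
  obtain ⟨j, hj⟩ := exists_hits_of_lt_supLowerRate (f := toralMap A) hφ (z := z)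
    (lt_of_lt_of_le (EReal.coe_lt_coe_iff.2 ht2) hτ)
  -- This mesh makes the pulled-back stable size exp(-(Lu+t)n), the same as the unstable one.
  refine σ.dimH_le_of_hits hinj (a := Ls + Lu + t) (by linarith) hκ0 (by linarith) (by linarith)
    hj ?_
  rw [div_lt_iff₀ hs0] at hκ1
  linarith

theorem bowenEntropy_le (σ : Splitting A Ls Lu m k) (hinj : Function.Injective (toralMap A))
    (hLs : 0 < Ls) (hLu : 0 < Lu) (hφ : ∀ j n, 0 < φ j n)
    (hτ : (τ : EReal) ≤ supLowerRate φ) (hτ0 : 0 ≤ τ) (hτLs : τ ≤ Ls) :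
    bowenEntropy (toralMap A) (⋂ j, shrinkingTarget (toralMap A) (φ j) (z j) Set.univ) ≤
      ENNReal.ofReal (m * ((Ls * Lu - τ * Lu) / (Lu + τ))) := by
  have hnn : 0 ≤ Ls * Lu - τ * Lu := by nlinarith
  refine le_ofReal_of_forall_lt_coe (by positivity) fun s hs => ?_
  obtain ⟨ε, hε, hε1, hε2⟩ : ∃ ε : ℝ, 0 < ε ∧ 0 < (Lu + τ - 2 * ε) / Lu ∧
      (Ls - τ + 2 * ε) * m < s * ((Lu + τ - 2 * ε) / Lu) := by
    have c1 : ContinuousAt (fun ε : ℝ => (Lu + τ - 2 * ε) / Lu) 0 := by fun_prop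
    have c2 : ContinuousAt (fun ε : ℝ => (Ls - τ + 2 * ε) * m) 0 := by fun_prop
    have h1 : ∀ᶠ ε in 𝓝[>] (0 : ℝ), 0 < (Lu + τ - 2 * ε) / Lu :=
      nhdsWithin_le_nhds (c1.eventually_const_lt (by simp; positivity))
    have h2 : ∀ᶠ ε in 𝓝[>] (0 : ℝ), (Ls - τ + 2 * ε) * m < s * ((Lu + τ - 2 * ε) / Lu) := by
      refine nhdsWithin_le_nhds (c2.eventually_lt (c1.const_mul _) ?_)
      simp only [mul_zero, sub_zero, add_zero]
      rw [← mul_div_assoc, lt_div_iff₀ hLu]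
      rw [← mul_div_assoc, div_lt_iff₀ (by linarith)] at hs
      linarith
    obtain ⟨ε, h⟩ := (eventually_mem_nhdsWithin.and (h1.and h2)).exists
    exact ⟨ε, h⟩
  obtain ⟨j, hj⟩ := exists_hits_of_lt_supLowerRate (f := toralMap A) hφ (z := z)
    (lt_of_lt_of_le (EReal.coe_lt_coe_iff.2 (show τ - ε < τ by linarith)) hτ)
  -- The mesh is as coarse as allowed. With t = τ - ε, the length ratio ℓ = (Lu+τ-2ε)/Lu satisfies
  -- Lu·ℓ < Lu + t.
  refine σ.bowenEntropy_le_of_hits hinj hLs hLu (a := Ls + ε) (by linarith) (by linarith) hε1 ?_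
    hj ?_
  · rw [mul_div_cancel₀ _ hLu.ne']; linarith
  · refine lt_of_eq_of_lt ?_ hε2
    ring

/-- For t > Ls the mesh can equal the target radius: the number of pieces is bounded in n while
their pull-backs still shrink exponentially, so every positive exponent works. -/
theorem eq_zero_of_lt (σ : Splitting A Ls Lu m k) (hinj : Function.Injective (toralMap A))
    (hLs : 0 < Ls) (hLu : 0 < Lu) (hφ : ∀ j n, 0 < φ j n) (hτ : (Ls : EReal) < supLowerRate φ) :
    bowenEntropy (toralMap A) (⋂ j, shrinkingTarget (toralMap A) (φ j) (z j) Set.univ) = 0 ∧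
      dimH (⋂ j, shrinkingTarget (toralMap A) (φ j) (z j) Set.univ) = 0 := by
  obtain ⟨t, ht1, ht2⟩ := EReal.lt_iff_exists_real_btwn.1 hτ
  have ht1 : Ls < t := by exact_mod_cast ht1
  obtain ⟨j, hj⟩ := exists_hits_of_lt_supLowerRate (f := toralMap A) hφ (z := z) ht2
  constructor
  · rw [← nonpos_iff_eq_zero, ← ENNReal.ofReal_zero]
    refine le_ofReal_of_forall_lt_coe le_rfl fun s hs => ?_
    exact σ.bowenEntropy_le_of_hits hinj hLs hLu (a := t) (ℓ := 1) le_rfl ht1 one_pos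
      (by linarith) hj (by simpa using hs)
  · rw [← nonpos_iff_eq_zero, ← ENNReal.ofReal_zero]
    refine le_ofReal_of_forall_lt_coe le_rfl fun s hs => ?_
    obtain ⟨κ, hκ1, hκ2⟩ := exists_between (show 0 < t - Ls by linarith)
    refine σ.dimH_le_of_hits hinj (a := t) le_rfl hκ1 hκ2 (by linarith) hj ?_
    rw [sub_self, zero_mul]
    positivity

end Splitting

end

end ShrinkingTarget

end

/-! ### The main theorem. -/

theorem theorem1p11 {d : ℕ} (A : Matrix.SpecialLinearGroup (Fin d) ℤ)
    (hA : ShrinkingTarget.IsHyperbolic (A : Matrix (Fin d) (Fin d) ℤ))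
    (lams lamu : ℂ)
    (hspec : spectrum ℂ (ShrinkingTarget.toComplex (A : Matrix (Fin d) (Fin d) ℤ)) = {lams, lamu})
    (hs0 : 0 < ‖lams‖) (hs1 : ‖lams‖ < 1) (hu1 : 1 < ‖lamu‖)
    (ds : ℕ)
    (hds : ds = (ShrinkingTarget.toComplex
      (A : Matrix (Fin d) (Fin d) ℤ)).charpoly.rootMultiplicity lams)
    (φ : ℕ → ℕ → ℝ) (hφ : ∀ j n, φ j n ∈ Set.Ioc (0 : ℝ) 1)
    (z : ℕ → ℕ → ShrinkingTarget.Torus d)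
    (f : ShrinkingTarget.Torus d → ShrinkingTarget.Torus d)
    (hf : f = ShrinkingTarget.toralMap (A : Matrix (Fin d) (Fin d) ℤ))
    (E : Set (ShrinkingTarget.Torus d))
    (hE : E = ⋂ j : ℕ, ShrinkingTarget.shrinkingTarget f (φ j) (z j) Set.univ)
    (τ : EReal) (hτ : τ = ShrinkingTarget.supLowerRate φ) :
    (τ < ((-Real.log ‖lams‖ : ℝ) : EReal) →
      E.Nonempty ∧
      ShrinkingTarget.bowenEntropy f E = ENNReal.ofReal
        (ds * ((Real.log ‖lams‖⁻¹ * Real.log ‖lamu‖ - τ.toReal * Real.log ‖lamu‖) /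
          (Real.log ‖lamu‖ + τ.toReal))) ∧
      dimH E = ENNReal.ofReal
        (ds * ((Real.log ‖lams‖⁻¹ + Real.log ‖lamu‖) / (Real.log ‖lamu‖ + τ.toReal)))) ∧
    (τ = ((-Real.log ‖lams‖ : ℝ) : EReal) →
      ShrinkingTarget.bowenEntropy f E = 0 ∧ dimH E ≤ (ds : ENNReal)) ∧
    (((-Real.log ‖lams‖ : ℝ) : EReal) < τ →
      ShrinkingTarget.bowenEntropy f E = 0 ∧ dimH E = 0) := by
  obtain ⟨k, hm, -, hvol, ⟨σ⟩⟩ := ShrinkingTarget.exists_splitting A hspec hs0 hs1 hu1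
  rw [← hds] at hm hvol σ
  have hLs : 0 < -Real.log ‖lams‖ := neg_pos.2 (Real.log_neg hs0 hs1)
  have hLu : 0 < Real.log ‖lamu‖ := Real.log_pos hu1
  have hinj := ShrinkingTarget.toralMap_injective A
  have hφ0 : ∀ j n, 0 < φ j n := fun j n => (hφ j n).1
  have hτ0 : 0 ≤ τ := hτ ▸ ShrinkingTarget.supLowerRate_nonneg hφ
  rw [Real.log_inv]
  set Ls := -Real.log ‖lams‖
  set Lu := Real.log ‖lamu‖
  subst hf hE
  refine ⟨fun h => ?_, fun h => ?_, fun h => σ.eq_zero_of_lt hinj hLs hLu hφ0 (hτ ▸ h)⟩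
  · lift τ to ℝ using ⟨h.ne_top, (lt_of_lt_of_le (by simp) hτ0).ne'⟩
    rw [EReal.toReal_coe]
    have h1 : τ < Ls := by exact_mod_cast h
    have h0 : 0 ≤ τ := by exact_mod_cast hτ0
    obtain ⟨hne, hent, hdim⟩ := σ.lower_bounds (z := z) hLs hLu hm hφ0 hτ.symm h0 h1
    have hpos : 0 < Lu + τ := by linarith
    -- Volume preservation, `hvol`, identifies the lower bounds, which involve k, with the upper
    -- ones.
    have e1 : Lu * (Lu * (1 - τ / Ls) / (Lu + τ)) * k =
        ds * ((Ls * Lu - τ * Lu) / (Lu + τ)) := by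
      field_simp
      linear_combination (-(Ls - τ)) * hvol
    have e2 : ds + Lu * (1 - τ / Ls) / (Lu + τ) * k = ds * ((Ls + Lu) / (Lu + τ)) := by
      field_simp
      linear_combination (-(Ls - τ)) * hvol
    rw [e1] at hent
    rw [e2] at hdim
    exact ⟨hne, le_antisymm (σ.bowenEntropy_le hinj hLs hLu hφ0 hτ.le h0 h1.le) hent,
      le_antisymm (σ.dimH_le hinj hLs hLu hφ0 hτ.le h0) hdim⟩
  -- The upper bounds at τ = Ls: the entropy formula becomes 0 and the dimension formula becomes
  -- `ds`.
  · have hle : (Ls : EReal) ≤ ShrinkingTarget.supLowerRate φ := (h.symm.trans hτ).le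
    constructor
    · have := σ.bowenEntropy_le (z := z) hinj hLs hLu hφ0 hle hLs.le le_rfl
      simpa using this
    · refine (σ.dimH_le (z := z) hinj hLs hLu hφ0 hle hLs.le).trans (le_of_eq ?_)
      rw [add_comm Ls, div_self (by linarith), mul_one, ENNReal.ofReal_natCast]
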